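/- Units: $\hbar=m=k=1$. On $L^2(\mathbb R)$ let $a=(x+\partial_x)/\sqrt2$ be the annihilation operator (maximal domain), $a^\dagger$ its adjoint, $|k\rangle$ ($k\ge 0$) the number states, $D(a^\dagger a)=\{\psi\in D(a): a\psi\in D(a^\dagger)\}$. For $\omega>0$ let $X=X_\omega=(a+a^\dagger)/\sqrt{2\omega}$, which is multiplication by $x/\sqrt\omega$. Fix $K,\tau\in\mathbb R$ and let the Floquet operator of the quantum kicked harmonic oscillator of frequency $\omega$ be $$U_\omega=e^{-iK\cos X_\omega}\,e^{-i\omega\tau a^\dagger a}$$ (free evolution for the time $\tau$, then a kick); in $\partial_\omega$ the quantities $\tau,K,a,a^\dagger$ are held fixed. For $t\in\mathbb N$ let $h(\omega;t)=i\,U_\omega^{\dagger t}\,\partial_\omega U_\omega^{t}$ be the generator of translations in $\omega$, defined on those $\psi$ for which $\omega'\mapsto U_{\omega'}^t\psi$ is norm differentiable at $\omega$. Put $S_1(t)=\frac{t(t-1)}2$ and $S_2(t)=\frac{t(t-1)(2t-1)}6$. Let $\omega>0$ be at the resonance $R=2$, that is, $\omega\tau=2\pi/R=\pi$. (1) For every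 $t\in\mathbb N$, the domain of $h(\omega;t)$ contains $D(a^\dagger a)$, and on $D(a^\dagger a)$, where every term is defined, $$h(\omega;t)=\tau\Big\{t\,a^\dagger a-\frac{iK S_1(t)}{\sqrt{2\omega}}\big(\sin X\,a-a^\dagger\sin X\big)+\frac{K^2S_2(t)}{2\omega}\sin^2X\Big\}+\frac{Kt}{2\omega}\,X\sin X .$$ The domain of the right-hand side (the intersection of the natural domains of its terms) is exactly $D(a^\dagger a)$. (2) If the period is instead started just before a kick, $U_\omega=e^{-i\omega\tau a^\dagger a}e^{-iK\cos X_\omega}$, the same holds with $S_1(t),S_2(t)$ replaced by $S_1(t+1),S_2(t+1)$. (3) For either order of the factors and every unit vector $\psi\in D(a^\dagger a)$, the quantum Fisher information $$I(\omega;\psi,t)=4\lim_{\varepsilon\to0}\frac{1-|\langle\psi|U_{\omega+\varepsilon}^{\dagger t}U_\omega^t|\psi\rangle|^2}{\varepsilon^2}$$ exists and equals $4\Delta^2_\psi h(\omega;t)$, where $\Delta^2_\psi h=\|h\psi\|^2-\langle\psi,h\psi\rangle^2$; and there is a real polynomial of degree at most $6$, depending on $\omega,\tau,K,\psi$ but not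 on $t$, whose value at every $t\in\mathbb N$ is $I(\omega;\psi,t)$. -/

import Mathlib

open MeasureTheory Filter Topology
open scoped SchwartzMap ENNReal

noncomputable section

namespace KHO

/-- The Hilbert space `L²(ℝ, ℂ)` of the oscillator, in the position representation. -/
abbrev L2 : Type := Lp ℂ 2 (volume : Measure ℝ)

/-! ### Ladder operators on Schwartz functions -/

/-- Multiplication by the dimensionless position `x`. -/
def posS : 𝓢(ℝ, ℂ) →ₗ[ℂ] 𝓢(ℝ, ℂ) :=
  (SchwartzMap.smulLeftCLM ℂ (fun x : ℝ => (x : ℂ))).toLinearMap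

/-- The derivative `d/dx`. -/
def derS : 𝓢(ℝ, ℂ) →ₗ[ℂ] 𝓢(ℝ, ℂ) := (SchwartzMap.derivCLM ℂ ℂ).toLinearMap

/-- The lowering operator `(x + d/dx)/√2` on Schwartz functions. -/
def lowerS : 𝓢(ℝ, ℂ) →ₗ[ℂ] 𝓢(ℝ, ℂ) := ((√2 : ℝ) : ℂ)⁻¹ • (posS + derS)

/-- The raising operator `(x - d/dx)/√2` on Schwartz functions. -/
def raiseS : 𝓢(ℝ, ℂ) →ₗ[ℂ] 𝓢(ℝ, ℂ) := ((√2 : ℝ) : ℂ)⁻¹ • (posS - derS)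

lemma posS_apply (f : 𝓢(ℝ, ℂ)) (x : ℝ) : posS f x = x * f x := by
  have h : Function.HasTemperateGrowth (fun x : ℝ => (x : ℂ)) := by fun_prop
  simp [posS, SchwartzMap.smulLeftCLM_apply_apply h]

lemma derS_apply (f : 𝓢(ℝ, ℂ)) (x : ℝ) : derS f x = deriv f x := by
  simp [derS]

lemma lowerS_apply (f : 𝓢(ℝ, ℂ)) (x : ℝ) :
    lowerS f x = ((√2 : ℝ) : ℂ)⁻¹ * (x * f x + deriv f x) := by
  simp [lowerS, posS_apply, derS_apply, mul_add]

lemma raiseS_apply (f : 𝓢(ℝ, ℂ)) (x : ℝ) :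
    raiseS f x = ((√2 : ℝ) : ℂ)⁻¹ * (x * f x - deriv f x) := by
  simp [raiseS, posS_apply, derS_apply]

/-- `(a + a†)/√(2ω)` is multiplication by `x/√ω`. -/
lemma posX_schwartz {ω : ℝ} (hω : 0 < ω) (f : 𝓢(ℝ, ℂ)) (x : ℝ) :
    ((√(2 * ω) : ℝ) : ℂ)⁻¹ * (lowerS f x + raiseS f x) = ((x / √ω : ℝ) : ℂ) * f x := by
  have h2 : ((√2 : ℝ) : ℂ) ≠ 0 := by simp
  have hw : ((√ω : ℝ) : ℂ) ≠ 0 := by exact_mod_cast (Real.sqrt_pos.2 hω).ne'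
  have h22 : ((√2 : ℝ) : ℂ) * ((√2 : ℝ) : ℂ) = 2 := by
    rw [← Complex.ofReal_mul, Real.mul_self_sqrt (by norm_num)]
    norm_num
  rw [lowerS_apply, raiseS_apply, Real.sqrt_mul (by norm_num)]
  push_cast
  field_simp
  linear_combination (-(x : ℂ) * f x) * h22

/-- The inclusion of the Schwartz functions in `L²(ℝ)`. -/
def incl : 𝓢(ℝ, ℂ) →ₗ[ℂ] L2 := (SchwartzMap.toLpCLM ℂ ℂ 2 (volume : Measure ℝ)).toLinearMap

lemma incl_apply (f : 𝓢(ℝ, ℂ)) : incl f = f.toLp 2 := rfl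

lemma incl_injective : Function.Injective incl := SchwartzMap.injective_toLp 2 volume

lemma inner_incl (f g : 𝓢(ℝ, ℂ)) :
    inner ℂ (incl f) (incl g) = ∫ x, (starRingEnd ℂ) (f x) * g x := by
  rw [incl_apply, incl_apply]
  refine (SchwartzMap.inner_toL2_toL2_eq f g volume).trans ?_
  simp [mul_comm]

/-! ### Number states -/

lemma gaussian_bound (k : ℕ) : ∃ C : ℝ, ∀ x : ℝ, |x| ^ k * Real.exp (-(x ^ 2 / 2)) ≤ C := by
  have h := tendsto_rpow_abs_mul_exp_neg_mul_sq_cocompact (a := 1 / 2) (by norm_num) k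
  have hc : Continuous fun x : ℝ => |x| ^ k * Real.exp (-(x ^ 2 / 2)) := by fun_prop
  have h' : Tendsto (fun x : ℝ => |x| ^ k * Real.exp (-(x ^ 2 / 2))) (cocompact ℝ) (𝓝 0) := by
    refine h.congr fun x => ?_
    rw [Real.rpow_natCast]
    ring_nf
  obtain ⟨C, hC⟩ := (ZeroAtInftyContinuousMap.isBounded_range
    (⟨⟨_, hc⟩, h'⟩ : ZeroAtInftyContinuousMap ℝ ℝ)).bddAbove
  exact ⟨C, fun x => hC ⟨x, rfl⟩⟩

lemma gaussian_poly_bound (p : Polynomial ℤ) :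
    ∃ C : ℝ, ∀ x : ℝ, |Polynomial.aeval x p| * Real.exp (-(x ^ 2 / 2)) ≤ C := by
  choose C hC using gaussian_bound
  refine ⟨∑ i ∈ p.support, |(p.coeff i : ℝ)| * C i, fun x => ?_⟩
  rw [Polynomial.aeval_eq_sum_range, ← Polynomial.aeval_eq_sum_range, Polynomial.aeval_def,
    Polynomial.eval₂_eq_sum, Polynomial.sum_def]
  calc _ ≤ (∑ i ∈ p.support, |(algebraMap ℤ ℝ) (p.coeff i) * x ^ i|) * Real.exp (-(x ^ 2 / 2)) := by
        gcongr
        exact Finset.abs_sum_le_sum_abs _ _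
    _ ≤ _ := by
        rw [Finset.sum_mul]
        refine Finset.sum_le_sum fun i _ => ?_
        rw [abs_mul, abs_pow, mul_assoc]
        exact mul_le_mul_of_nonneg_left (hC i x) (abs_nonneg _)

/-- The Gaussian `e^{-x²/2}` as a Schwartz function. -/
def gaussS : 𝓢(ℝ, ℝ) where
  toFun x := Real.exp (-(x ^ 2 / 2))
  smooth' := by fun_prop
  decay' k n := by
    obtain ⟨C, hC⟩ := gaussian_poly_bound (Polynomial.X ^ k * Polynomial.hermite n)
    refine ⟨C, fun x => ?_⟩
    rw [norm_iteratedFDeriv_eq_norm_iteratedDeriv, iteratedDeriv_eq_iterate,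
      Polynomial.deriv_gaussian_eq_hermite_mul_gaussian]
    refine le_trans (le_of_eq ?_) (hC x)
    simp [abs_mul, mul_assoc]

lemma gaussS_apply (x : ℝ) : gaussS x = Real.exp (-(x ^ 2 / 2)) := rfl

/-- The oscillator ground state `π^{-1/4} e^{-x²/2}`. -/
def vacS : 𝓢(ℝ, ℂ) :=
  ((Real.pi ^ (-(1 / 4) : ℝ) : ℝ) : ℂ) • SchwartzMap.postcompCLM Complex.ofRealCLM gaussS

lemma vacS_apply (x : ℝ) :
    vacS x = ((Real.pi ^ (-(1 / 4) : ℝ) * Real.exp (-(x ^ 2 / 2)) : ℝ) : ℂ) := by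
  simp [vacS, gaussS_apply]

/-- The number states `|k⟩ = (a†)ᵏ|0⟩ / √(k!)` (the normalised Hermite functions). -/
def numS (k : ℕ) : 𝓢(ℝ, ℂ) := ((√(k.factorial : ℝ) : ℝ) : ℂ)⁻¹ • (raiseS ^ k) vacS

/-- The number states as elements of `L²(ℝ)`. -/
def numState (k : ℕ) : L2 := incl (numS k)

lemma lowerS_vacS : lowerS vacS = 0 := by
  ext x
  have h : HasDerivAt (fun y : ℝ => vacS y) (-x * vacS x) x := by
    have h1 : HasDerivAt (fun y : ℝ => Real.pi ^ (-(1 / 4) : ℝ) * Real.exp (-(y ^ 2 / 2)))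
        (Real.pi ^ (-(1 / 4) : ℝ) * (Real.exp (-(x ^ 2 / 2)) * (-x))) x := by
      refine HasDerivAt.const_mul _ (HasDerivAt.exp ?_)
      have := ((hasDerivAt_pow 2 x).div_const 2).neg
      convert! this using 1
      simp
    have h2 := h1.ofReal_comp
    simp only [vacS_apply]
    convert! h2 using 1
    push_cast
    ring
  rw [lowerS_apply, show deriv (vacS : ℝ → ℂ) x = _ from h.deriv]
  simp

lemma norm_vacS : inner ℂ (incl vacS) (incl vacS) = 1 := by
  rw [inner_incl]
  simp only [vacS_apply, Complex.conj_ofReal, ← Complex.ofReal_mul]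
  rw [integral_complex_ofReal]
  have h : ∀ x : ℝ, Real.pi ^ (-(1 / 4) : ℝ) * Real.exp (-(x ^ 2 / 2)) *
      (Real.pi ^ (-(1 / 4) : ℝ) * Real.exp (-(x ^ 2 / 2))) =
      Real.pi ^ (-(1 / 2) : ℝ) * Real.exp (-1 * x ^ 2) := fun x => by
    rw [mul_mul_mul_comm, ← Real.rpow_add Real.pi_pos, ← Real.exp_add]
    ring_nf
  simp only [h]
  rw [integral_const_mul, integral_gaussian, div_one, Real.sqrt_eq_rpow,
    ← Real.rpow_add Real.pi_pos]
  norm_num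

/-- The raising and lowering operators are formal adjoints of each other. -/
lemma inner_raiseS (f g : 𝓢(ℝ, ℂ)) :
    inner ℂ (incl f) (incl (raiseS g)) = inner ℂ (incl (lowerS f)) (incl g) := by
  have hpos : inner ℂ (incl f) (incl (posS g)) = inner ℂ (incl (posS f)) (incl g) := by
    simp only [inner_incl, posS_apply, map_mul, Complex.conj_ofReal]
    congr 1; ext x; ring
  have hder : inner ℂ (incl f) (incl (derS g)) = -inner ℂ (incl (derS f)) (incl g) := by
    have h := SchwartzMap.integral_bilinear_deriv_right_eq_neg_left f g
      ((ContinuousLinearMap.mul ℝ ℂ).comp Complex.conjCLE.toContinuousLinearMap)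
    simpa [inner_incl, derS_apply] using h
  simp only [raiseS, lowerS, LinearMap.smul_apply, LinearMap.sub_apply, LinearMap.add_apply,
    map_smul, map_sub, map_add, inner_smul_left, inner_smul_right, inner_sub_right, inner_add_left,
    hpos, hder, map_inv₀, Complex.conj_ofReal]
  ring

/-- The canonical commutation relation `[a, a†] = 1`. -/
lemma lowerS_raiseS (f : 𝓢(ℝ, ℂ)) : lowerS (raiseS f) = raiseS (lowerS f) + f := by
  have hc : derS (posS f) = posS (derS f) + f := by
    ext x
    have h1 : HasDerivAt (fun y : ℝ => (y : ℂ) * f y) (1 * f x + x * deriv f x) x :=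
      (Complex.ofRealCLM.hasDerivAt (x := x)).mul (f.hasDerivAt x)
    have h2 : ⇑(posS f) = fun y : ℝ => (y : ℂ) * f y := funext (posS_apply f)
    rw [derS_apply, h2, h1.deriv]
    simp [posS_apply, derS_apply, add_comm]
  have h2 : ((√2 : ℝ) : ℂ)⁻¹ * ((√2 : ℝ) : ℂ)⁻¹ = 2⁻¹ := by
    rw [← mul_inv, ← Complex.ofReal_mul, Real.mul_self_sqrt (by norm_num)]
    norm_num
  simp only [raiseS, lowerS, LinearMap.smul_apply, LinearMap.sub_apply, LinearMap.add_apply,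
    map_smul, map_sub, map_add, hc]
  simp only [smul_add, smul_sub, smul_smul, h2]
  module

lemma lowerS_pow (k : ℕ) : lowerS ((raiseS ^ (k + 1)) vacS) = ((k : ℂ) + 1) • (raiseS ^ k) vacS := by
  induction k with
  | zero => simp [lowerS_raiseS, lowerS_vacS]
  | succ k ih =>
    rw [pow_succ', Module.End.mul_apply, lowerS_raiseS, ih, map_smul, ← Module.End.mul_apply,
      ← pow_succ']
    push_cast
    module

lemma inner_pow (m n : ℕ) : inner ℂ (incl ((raiseS ^ m) vacS)) (incl ((raiseS ^ n) vacS)) =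
    if m = n then (n.factorial : ℂ) else 0 := by
  induction n generalizing m with
  | zero =>
    cases m with
    | zero => simpa using norm_vacS
    | succ m =>
      rw [← inner_conj_symm, pow_succ', Module.End.mul_apply, inner_raiseS]
      simp [lowerS_vacS]
  | succ n ih =>
    rw [pow_succ' _ n, Module.End.mul_apply, inner_raiseS]
    cases m with
    | zero => simp [lowerS_vacS]
    | succ m =>
      rw [lowerS_pow, map_smul, inner_smul_left, ih]
      by_cases h : m = n
      · subst h; simp [Nat.factorial_succ]
      · simp [h]

lemma orthonormal_numState : Orthonormal ℂ numState := by
  rw [orthonormal_iff_ite]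
  intro m n
  simp only [numState, numS, map_smul, inner_smul_left, inner_smul_right, inner_pow]
  by_cases h : m = n
  · subst h
    have h0 : (0 : ℝ) < m.factorial := by exact_mod_cast m.factorial_pos
    have h1 : √(m.factorial : ℝ) ≠ 0 := (Real.sqrt_pos.2 h0).ne'
    simp only [if_true, map_inv₀, Complex.conj_ofReal]
    rw [← mul_assoc, ← mul_inv, ← Complex.ofReal_mul, Real.mul_self_sqrt h0.le]
    simpa using inv_mul_cancel₀ (by exact_mod_cast h0.ne' : (m.factorial : ℂ) ≠ 0)
  · simp [h]

/-! ### The Floquet operator -/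

/-- The states `e^{-iθk}|k⟩`. -/
def phased (θ : ℝ) (k : ℕ) : L2 := Complex.exp (-(Complex.I * θ * k)) • numState k

lemma orthonormal_phased (θ : ℝ) : Orthonormal ℂ (phased θ) := by
  have h := orthonormal_numState
  rw [orthonormal_iff_ite] at h ⊢
  intro m n
  simp only [phased, inner_smul_left, inner_smul_right, h]
  by_cases hmn : m = n
  · subst hmn
    simp [← Complex.exp_conj, ← Complex.exp_add]
  · simp [hmn]

/-- The unitary operator `e^{-iθ a†a}`, with `e^{-iθ a†a}|k⟩ = e^{-iθk}|k⟩`; see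
`hasSum_rotation` for its action on a general state. -/
def rotation (θ : ℝ) : L2 →L[ℂ] L2 :=
  (orthonormal_phased θ).orthogonalFamily.linearIsometry.toContinuousLinearMap ∘L
    ContinuousLinearMap.adjoint
      orthonormal_numState.orthogonalFamily.linearIsometry.toContinuousLinearMap

lemma hasSum_rotation (θ : ℝ) (ψ : L2) :
    HasSum (fun k : ℕ =>
      (Complex.exp (-(Complex.I * θ * k)) * inner ℂ (numState k) ψ) • numState k)
      (rotation θ ψ) := by
  have h := (orthonormal_phased θ).orthogonalFamily.hasSum_linearIsometry
    (ContinuousLinearMap.adjoint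
      orthonormal_numState.orthogonalFamily.linearIsometry.toContinuousLinearMap ψ)
  convert! h using 2 with k
  have hk : (ContinuousLinearMap.adjoint
      orthonormal_numState.orthogonalFamily.linearIsometry.toContinuousLinearMap ψ) k =
      inner ℂ (numState k) ψ := by
    have h1 := ContinuousLinearMap.adjoint_inner_right
      orthonormal_numState.orthogonalFamily.linearIsometry.toContinuousLinearMap
      (lp.single 2 k (1 : ℂ)) ψ
    rw [lp.inner_single_left, LinearIsometry.coe_toContinuousLinearMap,
      OrthogonalFamily.linearIsometry_apply_single] at h1
    simpa using h1
  simp [hk, phased, smul_smul, mul_comm]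

/-- The bounded operator `f(X)` for a bounded continuous `f`. As `X = (a + a†)/√(2ω)` acts in the
position representation as multiplication by `x/√ω`, it is multiplication by `f(x/√ω)`. -/
def funX (ω : ℝ) (f : BoundedContinuousFunction ℝ ℂ) : L2 →L[ℂ] L2 :=
  (ContinuousLinearMap.lsmul ℂ ℂ).holderL volume ∞ 2 2
    (MemLp.toLp (fun x : ℝ => f (x / √ω))
      (memLp_top_of_bound (by fun_prop) ‖f‖ (ae_of_all _ fun x => f.norm_coe_le_norm _)))

lemma coeFn_funX (ω : ℝ) (f : BoundedContinuousFunction ℝ ℂ) (ψ : L2) :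
    funX ω f ψ =ᵐ[volume] fun x => f (x / √ω) * ψ x := by
  have hm : MemLp (fun x : ℝ => f (x / √ω)) ∞ (volume : Measure ℝ) :=
    memLp_top_of_bound (by fun_prop) ‖f‖ (ae_of_all _ fun x => f.norm_coe_le_norm _)
  have h : funX ω f ψ =ᵐ[volume] fun x => hm.toLp _ x * ψ x :=
    (ContinuousLinearMap.lsmul ℂ ℂ).coeFn_holder (hm.toLp _) ψ
  filter_upwards [h, hm.coeFn_toLp] with x h1 h2
  rw [h1, h2]

/-- The function `sin`. -/
def sinB : BoundedContinuousFunction ℝ ℂ :=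
  BoundedContinuousFunction.ofNormedAddCommGroup (fun x : ℝ => ((Real.sin x : ℝ) : ℂ))
    (by fun_prop) 1 (fun x => by simpa [← Complex.ofReal_sin] using Real.abs_sin_le_one x)

/-- The function `e^{-iK cos}`. -/
def kickB (K : ℝ) : BoundedContinuousFunction ℝ ℂ :=
  BoundedContinuousFunction.ofNormedAddCommGroup
    (fun x : ℝ => Complex.exp (((-(K * Real.cos x) : ℝ) : ℂ) * Complex.I))
    (by fun_prop) 1 (fun x => (Complex.norm_exp_ofReal_mul_I _).le)

/-- The operator `sin X`. -/
def sinX (ω : ℝ) : L2 →L[ℂ] L2 := funX ω sinB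

/-- The kick `e^{-iK cos X}`. -/
def kick (K ω : ℝ) : L2 →L[ℂ] L2 := funX ω (kickB K)

/-- One period of the kicked oscillator of frequency `ω`: free evolution for the time `τ`, followed
by a kick, `e^{-iK cos X} e^{-iωτ a†a}`. -/
def floquet (τ K ω : ℝ) : L2 →L[ℂ] L2 := kick K ω ∘L rotation (ω * τ)

/-- The same period started just before a kick, `e^{-iωτ a†a} e^{-iK cos X}`. -/
def floquetKickFirst (τ K ω : ℝ) : L2 →L[ℂ] L2 := rotation (ω * τ) ∘L kick K ω

/-! ### Unbounded operators -/

/-- An operator on Schwartz functions as a densely defined operator on `L²(ℝ)`. -/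
def onSchwartz (A : 𝓢(ℝ, ℂ) →ₗ[ℂ] 𝓢(ℝ, ℂ)) : L2 →ₗ.[ℂ] L2 where
  domain := LinearMap.range incl
  toFun := incl ∘ₗ A ∘ₗ (LinearEquiv.ofInjective incl incl_injective).symm.toLinearMap

/-- The annihilation operator `a = (x + d/dx)/√2` with its maximal domain, the derivative being
taken weakly: `aψ = φ` iff `⟨(x - d/dx)g/√2, ψ⟩ = ⟨g, φ⟩` for all Schwartz functions `g`. -/
def annih : L2 →ₗ.[ℂ] L2 := (onSchwartz raiseS).adjoint

/-- The creation operator `a†`. -/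
def creat : L2 →ₗ.[ℂ] L2 := annih.adjoint

/-- The product `S T` of unbounded operators, with its natural domain
`{ψ ∈ D(T) | T ψ ∈ D(S)}`. -/
def opMul (S T : L2 →ₗ.[ℂ] L2) : L2 →ₗ.[ℂ] L2 :=
  S.comp (T.domRestrict ((S.domain.comap T.toFun).map T.domain.subtype)) (by
    rintro ⟨x, ⟨y, hy, rfl⟩, hx⟩
    exact hy)

lemma mem_opMul_domain (S T : L2 →ₗ.[ℂ] L2) (ψ : L2) :
    ψ ∈ (opMul S T).domain ↔ ∃ h : ψ ∈ T.domain, T ⟨ψ, h⟩ ∈ S.domain := by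
  constructor
  · rintro ⟨⟨y, hy, rfl⟩, h⟩
    exact ⟨h, hy⟩
  · rintro ⟨h, h'⟩
    exact ⟨⟨⟨ψ, h⟩, h', rfl⟩, h⟩

lemma opMul_apply (S T : L2 →ₗ.[ℂ] L2) (ψ : (opMul S T).domain) (h : (ψ : L2) ∈ T.domain)
    (h' : T ⟨ψ, h⟩ ∈ S.domain) : opMul S T ψ = S ⟨T ⟨ψ, h⟩, h'⟩ := rfl

/-- A bounded operator, as an everywhere defined operator. -/
def ofBdd (B : L2 →L[ℂ] L2) : L2 →ₗ.[ℂ] L2 := B.toLinearMap.toPMap ⊤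

/-- The number operator `a†a`, with domain `{ψ ∈ D(a) | aψ ∈ D(a†)}`. -/
def number : L2 →ₗ.[ℂ] L2 := opMul creat annih

/-- The position operator `X = (a + a†)/√(2ω)`. -/
def posX (ω : ℝ) : L2 →ₗ.[ℂ] L2 := (((√(2 * ω))⁻¹ : ℝ) : ℂ) • (annih + creat)

/-- The operator
`τ{t a†a - (iK s₁/√(2ω))(sin X a - a† sin X) + (K² s₂/(2ω)) sin² X} + (Kt/(2ω)) X sin X`,
on the intersection of the domains of its terms. -/
def closedForm (ω τ K t s₁ s₂ : ℝ) : L2 →ₗ.[ℂ] L2 :=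
  (τ : ℂ) •
      ((t : ℂ) • number
        - (Complex.I * K * s₁ / (√(2 * ω) : ℝ)) •
            (opMul (ofBdd (sinX ω)) annih - opMul creat (ofBdd (sinX ω)))
        + ((K ^ 2 * s₂ / (2 * ω) : ℝ) : ℂ) • ofBdd (sinX ω ∘L sinX ω))
    + ((K * t / (2 * ω) : ℝ) : ℂ) • opMul (posX ω) (ofBdd (sinX ω))

/-- `S₁(t) = t(t-1)/2`. -/
def S1 (t : ℝ) : ℝ := t * (t - 1) / 2

/-- `S₂(t) = t(t-1)(2t-1)/6`. -/
def S2 (t : ℝ) : ℝ := t * (t - 1) * (2 * t - 1) / 6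

/-! ### The generator and the quantum Fisher information -/

/-- The generator `h(ω;t) = i (U_ω^t)† ∂_ω U_ω^t` of translations in `ω` of a family `U` of
operators; its domain consists of all `ψ` for which `ω ↦ U_ω^t ψ` is differentiable at `ω`. -/
def generator (U : ℝ → L2 →L[ℂ] L2) (ω : ℝ) (t : ℕ) : L2 →ₗ.[ℂ] L2 where
  domain :=
    { carrier := {ψ | DifferentiableAt ℝ (fun w : ℝ => (U w ^ t) ψ) ω}
      add_mem' := fun {a b} ha hb => by
        have h : DifferentiableAt ℝ (fun w : ℝ => (U w ^ t) a + (U w ^ t) b) ω := ha.add hb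
        simpa only [Set.mem_ofPred_eq, map_add] using! h
      zero_mem' := by simp
      smul_mem' := fun c a ha => by
        have h : DifferentiableAt ℝ (fun w : ℝ => c • (U w ^ t) a) ω := ha.const_smul c
        simpa only [Set.mem_ofPred_eq, map_smul] using! h }
  toFun :=
    { toFun := fun ψ =>
        Complex.I • ContinuousLinearMap.adjoint (U ω ^ t) (deriv (fun w : ℝ => (U w ^ t) ψ.1) ω)
      map_add' := fun a b => by
        have h : deriv (fun w : ℝ => (U w ^ t) a.1 + (U w ^ t) b.1) ω = _ :=
          deriv_add a.2 b.2
        simp only [Submodule.coe_add, map_add, h, smul_add]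
      map_smul' := fun c a => by
        have h : deriv (fun w : ℝ => c • (U w ^ t) a.1) ω = _ := deriv_const_smul c a.2
        simp only [Submodule.coe_smul, map_smul, h, RingHom.id_apply, smul_comm c] }

/-- The variance `⟨T²⟩ - ⟨T⟩²` of a symmetric operator `T` in the unit vector `ψ ∈ D(T)`, where
`⟨T²⟩ = ‖Tψ‖²`. -/
def variance (T : L2 →ₗ.[ℂ] L2) (ψ : T.domain) : ℝ :=
  ‖T ψ‖ ^ 2 - (inner ℂ (ψ : L2) (T ψ)).re ^ 2

/-- The quantum Fisher information of `U_ω^t ψ` about `ω` equals `I`: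
`4 (1 - |⟨ψ| (U_{ω+ε}^t)† U_ω^t |ψ⟩|²)/ε² → I` as `ε → 0`. -/
def IsQFI (U : ℝ → L2 →L[ℂ] L2) (ω : ℝ) (t : ℕ) (ψ : L2) (I : ℝ) : Prop :=
  Tendsto (fun ε : ℝ =>
      4 * ((1 - ‖inner ℂ ψ (ContinuousLinearMap.adjoint (U (ω + ε) ^ t) ((U ω ^ t) ψ))‖ ^ 2)
        / ε ^ 2))
    (𝓝[≠] 0) (𝓝 I)

end KHO

end

noncomputable section

namespace KHO

/-! ### Testing against Schwartz functions -/

/-! At `ω * τ = π` the free evolution is the parity operator `P`, by comparison of coefficients in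
the number basis (`rotation_pi`). The kick is an even function of `X`, so it commutes with `P`, and
`U^s = P^s e^{-isK cos X}` (`floquet_pow_apply`).

The product rule gives `∂(U^t)ψ = -i U^t Σ_{s<t} g_s`, where `g_s` is the generator of a single
period carried back through `U^s` (`hasDerivAt_pow_apply`). For one period the generator is `τ a†a`
plus `K/(2ω) X sin X`. The second term commutes with parity and kicks, so it is the same for every
`s`. The first commutes with parity but not with kicks: conjugating `a†a` by a kick of strength `sK`
adds a term linear and a term quadratic in `s` (`IsNum.kick`). Summing over `s < t` turns `s` and
`s²` into `S₁(t)` and `S₂(t)`. If the kick comes first, the free evolution of period `s` has already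
seen `s + 1` kicks, hence the shifted argument.

The analytic content is that all this holds on the whole of `D(a†a)`. Completeness of the number
states (`eq_zero_of_inner_numState`) makes the free evolution isometric and yields `D(a) ⊆ D(a†)`
(`IsAnn.exists_isCre`), hence `xψ ∈ L²` on `D(a)`. Each factor is then strongly differentiable by
dominated convergence, over number coefficients for the rotation and over `x` for the kick. Because
the factors are isometries, strong continuity suffices for the product rule. The unbounded operators
are handled through their graphs `IsAnn`, `IsCre`, `IsNum`.

For the Fisher information, the infidelity of unit vectors is the squared norm of the component
orthogonal to the base vector, so the limit is the variance of the generator (`tendsto_fidelity`).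
The generator applied to `ψ` is a combination of fixed vectors with real polynomial coefficients in
`t` of degree at most three, so its variance has degree at most six. -/

lemma inner_incl_left (f : 𝓢(ℝ, ℂ)) (ψ : L2) :
    inner ℂ (incl f) ψ = ∫ x, (starRingEnd ℂ) (f x) * ψ x := by
  rw [L2.inner_def]
  refine integral_congr_ae ?_
  filter_upwards [f.coeFn_toLp 2 volume] with x hx
  rw [incl_apply, hx, RCLike.inner_apply, mul_comm]

lemma dense_range_incl : Dense (LinearMap.range incl : Set L2) := by
  have h := SchwartzMap.denseRange_toLpCLM (E := ℝ) (F := ℂ) (μ := volume) (p := 2) (by simp)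
  rw [LinearMap.coe_range]
  intro x
  exact h x

/-- Complex conjugation of a Schwartz function. -/
def conjS (f : 𝓢(ℝ, ℂ)) : 𝓢(ℝ, ℂ) :=
  SchwartzMap.postcompCLM (𝕜 := ℝ) Complex.conjCLE.toContinuousLinearMap f

lemma conjS_apply (f : 𝓢(ℝ, ℂ)) (x : ℝ) : conjS f x = (starRingEnd ℂ) (f x) := rfl

lemma ae_eq_zero_of_integral_schwartz {h : ℝ → ℂ} (hl : LocallyIntegrable h volume)
    (h0 : ∀ f : 𝓢(ℝ, ℂ), ∫ x, f x * h x = 0) : h =ᵐ[volume] 0 := by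
  refine ae_eq_zero_of_integral_contDiff_smul_eq_zero hl fun g hg hgs => ?_
  have hc : HasCompactSupport fun x => (g x : ℂ) := hgs.comp_left (g := fun y : ℝ => (y : ℂ)) (by simp)
  have hs : ContDiff ℝ (⊤ : ℕ∞) fun x => (g x : ℂ) := Complex.ofRealCLM.contDiff.comp hg
  exact h0 (hc.toSchwartzMap hs)

/-! ### Completeness of the number states -/

/-- Expand the exponential in powers of `x` and integrate term by term. The partial sums are
dominated by `e^{|c||x|} ‖h‖`, which is why exponential moments are assumed. -/
lemma fourier_eq_zero_of_moments {h : ℝ → ℂ} (hm : AEStronglyMeasurable h volume)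
    (hi : ∀ c : ℝ, Integrable (fun x => Real.exp (c * |x|) * ‖h x‖))
    (h0 : ∀ n : ℕ, ∫ x : ℝ, (x : ℂ) ^ n * h x = 0) (c : ℝ) :
    ∫ x : ℝ, Complex.exp ((c * x : ℝ) * Complex.I) * h x = 0 := by
  have hs := hasSum_integral_of_dominated_convergence (μ := (volume : Measure ℝ))
    (F := fun (n : ℕ) (x : ℝ) => (((c * x : ℝ) * Complex.I) ^ n / (n.factorial : ℂ)) * h x)
    (f := fun x : ℝ => Complex.exp ((c * x : ℝ) * Complex.I) * h x)
    (fun (n : ℕ) (x : ℝ) => ((|c| * |x|) ^ n / (n.factorial : ℝ)) * ‖h x‖) ?_ ?_ ?_ ?_ ?_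
  · refine hs.unique ?_
    convert! hasSum_zero with n
    have : ∀ x : ℝ, (((c * x : ℝ) * Complex.I) ^ n / (n.factorial : ℂ)) * h x =
        ((c * Complex.I) ^ n / (n.factorial : ℂ)) * ((x : ℂ) ^ n * h x) := fun x => by
      push_cast; ring
    simp only [this]
    rw [integral_const_mul, h0, mul_zero]
  · intro n
    exact (Continuous.aestronglyMeasurable (by fun_prop)).mul hm
  · refine fun n => ae_of_all _ fun x => ?_
    simp
  · refine ae_of_all _ fun x => ?_
    exact (Real.summable_pow_div_factorial _).mul_right _
  · refine (hi |c|).congr (ae_of_all _ fun x => ?_)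
    simp only [tsum_mul_right, Real.exp_eq_exp_ℝ, NormedSpace.exp_eq_tsum_div]
  · refine ae_of_all _ fun x => ?_
    refine HasSum.mul_right _ ?_
    rw [Complex.exp_eq_exp_ℂ]
    exact NormedSpace.expSeries_div_hasSum_exp _

lemma ae_eq_zero_of_moments {h : ℝ → ℂ} (hm : AEStronglyMeasurable h volume)
    (hi : ∀ c : ℝ, Integrable (fun x => Real.exp (c * |x|) * ‖h x‖))
    (h0 : ∀ n : ℕ, ∫ x : ℝ, (x : ℂ) ^ n * h x = 0) : h =ᵐ[volume] 0 := by
  have hint : Integrable h := by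
    rw [← integrable_norm_iff hm]
    simpa using hi 0
  refine ae_eq_zero_of_integral_schwartz hint.locallyIntegrable fun f => ?_
  have hf : FourierTransform.fourier (FourierTransformInv.fourierInv f) = f :=
    FourierTransform.fourier_fourierInv_eq f
  -- The Fourier transform moves from the Schwartz factor onto `h`, whose transform vanishes.
  have key := VectorFourier.integral_fourierIntegral_smul_eq_flip (μ := (volume : Measure ℝ))
    (ν := (volume : Measure ℝ)) (L := innerₗ ℝ)
    (f := FourierTransformInv.fourierInv f) (g := h) Real.continuous_fourierChar continuous_inner
    (FourierTransformInv.fourierInv f).integrable hint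
  have hz : ∀ x, VectorFourier.fourierIntegral Real.fourierChar volume (innerₗ ℝ).flip h x = 0 := by
    intro x
    rw [← fourier_eq_zero_of_moments hm hi h0 (-(2 * Real.pi * x))]
    refine integral_congr_ae (ae_of_all _ fun y => ?_)
    simp only [Circle.smul_def, Real.fourierChar_apply, smul_eq_mul]
    congr 3
    simp
    ring
  simp only [hz, smul_zero, integral_zero] at key
  rw [← key]
  refine integral_congr_ae (ae_of_all _ fun x => ?_)
  simp only [smul_eq_mul]
  congr 1
  conv_lhs => rw [← hf]
  rfl

lemma memLp_exp_abs_gaussian (c : ℝ) :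
    MemLp (fun x : ℝ => Real.exp (c * |x|) * Real.exp (-(x ^ 2 / 2))) 2 (volume : Measure ℝ) := by
  rw [memLp_two_iff_integrable_sq (Continuous.aestronglyMeasurable (by fun_prop))]
  refine ((integrable_exp_neg_mul_sq (b := 1 / 2) (by norm_num)).const_mul
    (Real.exp (2 * c ^ 2))).mono' (Continuous.aestronglyMeasurable (by fun_prop))
    (ae_of_all _ fun x => ?_)
  rw [Real.norm_of_nonneg (sq_nonneg _), ← Real.exp_add, ← Real.exp_add, ← Real.exp_nat_mul]
  refine Real.exp_le_exp.2 ?_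
  push_cast
  -- Completing the square: `2c|x| - x² ≤ 2c² - x²/2`.
  nlinarith [sq_nonneg (2 * c - |x|), sq_abs x]

/-- The Schwartz functions spanned by the number states. -/
def hermiteSpan : Submodule ℂ 𝓢(ℝ, ℂ) := Submodule.span ℂ (Set.range fun k => (raiseS ^ k) vacS)

lemma posS_eq : posS = ((√2 : ℝ) : ℂ)⁻¹ • (raiseS + lowerS) := by
  have h2 : ((√2 : ℝ) : ℂ)⁻¹ * ((√2 : ℝ) : ℂ)⁻¹ = 2⁻¹ := by
    rw [← mul_inv, ← Complex.ofReal_mul, Real.mul_self_sqrt (by norm_num)]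
    norm_num
  rw [raiseS, lowerS, ← smul_add, smul_smul, h2]
  module

lemma posS_mem_hermiteSpan {f : 𝓢(ℝ, ℂ)} (hf : f ∈ hermiteSpan) : posS f ∈ hermiteSpan := by
  induction hf using Submodule.span_induction with
  | mem x hx =>
    obtain ⟨k, rfl⟩ := hx
    have hr : raiseS ((raiseS ^ k) vacS) ∈ hermiteSpan :=
      Submodule.subset_span ⟨k + 1, by simp [pow_succ']⟩
    have hl : lowerS ((raiseS ^ k) vacS) ∈ hermiteSpan := by
      cases k with
      | zero => simp [lowerS_vacS]
      | succ k =>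
        rw [lowerS_pow]
        exact Submodule.smul_mem _ _ (Submodule.subset_span ⟨k, rfl⟩)
    rw [posS_eq]
    exact Submodule.smul_mem _ _ (Submodule.add_mem _ hr hl)
  | zero => simp
  | add x y _ _ hx hy => rw [map_add]; exact Submodule.add_mem _ hx hy
  | smul c x _ hx => rw [map_smul]; exact Submodule.smul_mem _ _ hx

/-- The span of the number states is stable under multiplication by `x`, so it contains every `x^n
e^{-x²/2}`. Orthogonality to it therefore kills all moments of `e^{-x²/2} ψ`, and the Gaussian
factor, which supplies the exponential moments, never vanishes. -/
lemma eq_zero_of_inner_numState {ψ : L2} (h : ∀ k, inner ℂ (numState k) ψ = 0) : ψ = 0 := by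
  have h1 : ∀ f ∈ hermiteSpan, inner ℂ (incl f) ψ = 0 := by
    intro f hf
    induction hf using Submodule.span_induction with
    | mem x hx =>
      obtain ⟨k, rfl⟩ := hx
      have hk := h k
      have hne : ((√(k.factorial : ℝ) : ℝ) : ℂ)⁻¹ ≠ 0 := by
        refine inv_ne_zero (Complex.ofReal_ne_zero.2 ?_)
        exact (Real.sqrt_pos.2 (by exact_mod_cast k.factorial_pos)).ne'
      rw [numState, numS, map_smul, inner_smul_left] at hk
      exact (mul_eq_zero.1 hk).resolve_left (by simpa using hne)
    | zero => simp
    | add x y _ _ hx hy => rw [map_add, inner_add_left, hx, hy, add_zero]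
    | smul c x _ hx => rw [map_smul, inner_smul_left, hx, mul_zero]
  have h2 : ∀ n : ℕ, ∀ x : ℝ, (posS ^ n) vacS x = (x : ℂ) ^ n * vacS x := by
    intro n
    induction n with
    | zero => simp
    | succ n ih => intro x; rw [pow_succ', Module.End.mul_apply, posS_apply, ih]; ring
  have h3 : ∀ n : ℕ, (posS ^ n) vacS ∈ hermiteSpan := by
    intro n
    induction n with
    | zero => exact Submodule.subset_span ⟨0, by simp⟩
    | succ n ih => rw [pow_succ', Module.End.mul_apply]; exact posS_mem_hermiteSpan ih
  have hπ : (0 : ℝ) < Real.pi ^ (-(1 / 4) : ℝ) := Real.rpow_pos_of_pos Real.pi_pos _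
  have hz : (fun x => vacS x * ψ x) =ᵐ[volume] 0 := by
    refine ae_eq_zero_of_moments
      (vacS.continuous.aestronglyMeasurable.mul (Lp.aestronglyMeasurable ψ)) (fun c => ?_)
      (fun n => ?_)
    · have := ((memLp_exp_abs_gaussian c).integrable_mul (Lp.memLp ψ).norm).const_mul
        (Real.pi ^ (-(1 / 4) : ℝ))
      refine this.congr (ae_of_all _ fun x => ?_)
      simp only [norm_mul, vacS_apply, Complex.norm_real, Real.norm_eq_abs, abs_of_pos hπ,
        Real.abs_exp, Pi.mul_apply]
      ring
    · rw [← h1 _ (h3 n), inner_incl_left]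
      refine integral_congr_ae (ae_of_all _ fun x => ?_)
      simp only [h2, vacS_apply, map_mul, map_pow, Complex.conj_ofReal]
      ring
  rw [Lp.eq_zero_iff_ae_eq_zero]
  filter_upwards [hz] with x hx
  refine (mul_eq_zero.1 hx).resolve_left ?_
  rw [vacS_apply]
  exact Complex.ofReal_ne_zero.2 (by positivity)

/-- The number states as a Hilbert basis. -/
def numBasis : HilbertBasis ℕ ℂ L2 :=
  HilbertBasis.mkOfOrthogonalEqBot orthonormal_numState (by
    refine (Submodule.eq_bot_iff _).2 fun ψ hψ => eq_zero_of_inner_numState fun k => ?_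
    exact hψ _ (Submodule.subset_span ⟨k, rfl⟩))

lemma numBasis_apply (k : ℕ) : numBasis k = numState k := by
  simp [numBasis]

lemma hasSum_norm_sq_coeff (ψ : L2) :
    HasSum (fun k => ‖inner ℂ (numState k) ψ‖ ^ 2) (‖ψ‖ ^ 2) := by
  have h := numBasis.hasSum_inner_mul_inner ψ ψ
  have h2 := Complex.hasSum_re h
  convert! h2 using 1
  · ext k
    rw [numBasis_apply, ← inner_conj_symm ψ, Complex.conj_mul']
    norm_cast
  · rw [inner_self_eq_norm_sq_to_K]
    norm_cast

lemma exists_coeff_eq {c : ℕ → ℂ} (hc : Summable fun k => ‖c k‖ ^ 2) :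
    ∃ χ : L2, ∀ k, inner ℂ (numState k) χ = c k := by
  have hm : Memℓp c 2 := by
    refine memℓp_gen ?_
    simpa using hc
  refine ⟨numBasis.repr.symm ⟨c, hm⟩, fun k => ?_⟩
  rw [← numBasis_apply, ← HilbertBasis.repr_apply_apply, LinearIsometryEquiv.apply_symm_apply]

lemma ext_coeff {φ ψ : L2} (h : ∀ k, inner ℂ (numState k) φ = inner ℂ (numState k) ψ) : φ = ψ := by
  rw [← sub_eq_zero]
  refine eq_zero_of_inner_numState fun k => ?_
  rw [inner_sub_right, h, sub_self]

/-! ### The graphs of the ladder operators -/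

/-- The graph of `annih`. -/
def IsAnn (ψ φ : L2) : Prop := ∀ g : 𝓢(ℝ, ℂ), inner ℂ (incl (raiseS g)) ψ = inner ℂ (incl g) φ

/-- The graph of `creat`. -/
def IsCre (ψ χ : L2) : Prop := ∀ φ α : L2, IsAnn φ α → inner ℂ α ψ = inner ℂ φ χ

/-- The graph of `number`. -/
def IsNum (ψ ν : L2) : Prop := ∃ φ, IsAnn ψ φ ∧ IsCre φ ν

lemma isAnn_incl (f : 𝓢(ℝ, ℂ)) : IsAnn (incl f) (incl (lowerS f)) := fun g => by
  rw [← inner_conj_symm, inner_raiseS, inner_conj_symm]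

lemma incl_mem_onSchwartz (A : 𝓢(ℝ, ℂ) →ₗ[ℂ] 𝓢(ℝ, ℂ)) (f : 𝓢(ℝ, ℂ)) :
    incl f ∈ (onSchwartz A).domain := ⟨f, rfl⟩

lemma onSchwartz_apply (A : 𝓢(ℝ, ℂ) →ₗ[ℂ] 𝓢(ℝ, ℂ)) (f : 𝓢(ℝ, ℂ)) (h : incl f ∈ (onSchwartz A).domain) :
    onSchwartz A ⟨incl f, h⟩ = incl (A f) := by
  have : (LinearEquiv.ofInjective incl incl_injective).symm ⟨incl f, h⟩ = f := by
    rw [LinearEquiv.symm_apply_eq]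
    rfl
  change incl (A ((LinearEquiv.ofInjective incl incl_injective).symm ⟨incl f, h⟩)) = _
  rw [this]

lemma isAnn_iff {ψ φ : L2} : IsAnn ψ φ ↔ ∃ h : ψ ∈ annih.domain, annih ⟨ψ, h⟩ = φ := by
  have hd : Dense ((onSchwartz raiseS).domain : Set L2) := dense_range_incl
  constructor
  · intro h
    have hx : ∀ x : (onSchwartz raiseS).domain, inner ℂ φ (x : L2) = inner ℂ ψ (onSchwartz raiseS x) := by
      rintro ⟨x, hx⟩
      obtain ⟨g, rfl⟩ : ∃ g, incl g = x := hx
      rw [onSchwartz_apply raiseS g (incl_mem_onSchwartz _ g), ← inner_conj_symm, ← h g, inner_conj_symm]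
    exact ⟨LinearPMap.mem_adjoint_domain_of_exists _ ⟨φ, hx⟩, LinearPMap.adjoint_apply_eq hd _ hx⟩
  · rintro ⟨h, rfl⟩ g
    have := LinearPMap.adjoint_isFormalAdjoint hd ⟨ψ, h⟩ ⟨incl g, incl_mem_onSchwartz _ g⟩
    rw [onSchwartz_apply] at this
    rw [← inner_conj_symm, ← inner_conj_symm (incl g)]
    exact congrArg _ this.symm

lemma dense_annih_domain : Dense (annih.domain : Set L2) := by
  refine dense_range_incl.mono ?_
  rintro _ ⟨f, rfl⟩
  exact (isAnn_iff.1 (isAnn_incl f)).1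

lemma isCre_iff {ψ χ : L2} : IsCre ψ χ ↔ ∃ h : ψ ∈ creat.domain, creat ⟨ψ, h⟩ = χ := by
  constructor
  · intro h
    have hx : ∀ x : annih.domain, inner ℂ χ (x : L2) = inner ℂ ψ (annih x) := by
      intro x
      rw [← inner_conj_symm, ← h x (annih x) (isAnn_iff.2 ⟨x.2, rfl⟩), inner_conj_symm]
    exact ⟨LinearPMap.mem_adjoint_domain_of_exists _ ⟨χ, hx⟩,
      LinearPMap.adjoint_apply_eq dense_annih_domain _ hx⟩
  · rintro ⟨h, rfl⟩ φ α hφ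
    obtain ⟨h', rfl⟩ := isAnn_iff.1 hφ
    have := LinearPMap.adjoint_isFormalAdjoint dense_annih_domain ⟨ψ, h⟩ ⟨φ, h'⟩
    rw [← inner_conj_symm, ← inner_conj_symm φ]
    exact congrArg _ this.symm

lemma isNum_iff {ψ ν : L2} : IsNum ψ ν ↔ ∃ h : ψ ∈ number.domain, number ⟨ψ, h⟩ = ν := by
  constructor
  · rintro ⟨φ, ha, hc⟩
    obtain ⟨h1, rfl⟩ := isAnn_iff.1 ha
    obtain ⟨h2, rfl⟩ := isCre_iff.1 hc
    exact ⟨(mem_opMul_domain _ _ _).2 ⟨h1, h2⟩, opMul_apply _ _ _ h1 h2⟩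
  · rintro ⟨h, rfl⟩
    obtain ⟨h1, h2⟩ := (mem_opMul_domain _ _ _).1 h
    exact ⟨_, isAnn_iff.2 ⟨h1, rfl⟩, isCre_iff.2 ⟨h2, (opMul_apply _ _ ⟨ψ, h⟩ h1 h2).symm⟩⟩

lemma IsCre.add {ψ ψ' φ φ' : L2} (h : IsCre ψ φ) (h' : IsCre ψ' φ') : IsCre (ψ + ψ') (φ + φ') :=
  fun φ α hα => by rw [inner_add_right, inner_add_right, h φ α hα, h' φ α hα]

lemma IsCre.smul {ψ φ : L2} (h : IsCre ψ φ) (c : ℂ) : IsCre (c • ψ) (c • φ) :=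
  fun φ α hα => by rw [inner_smul_right, inner_smul_right, h φ α hα]

/-! ### Matrix elements in the number basis -/

lemma raiseS_numS (k : ℕ) : raiseS (numS k) = ((√((k : ℝ) + 1) : ℝ) : ℂ) • numS (k + 1) := by
  have h1 : ((√((k : ℝ) + 1) : ℝ) : ℂ) ≠ 0 :=
    Complex.ofReal_ne_zero.2 (Real.sqrt_pos.2 (by positivity)).ne'
  rw [numS, numS, map_smul, smul_smul, pow_succ', Module.End.mul_apply, Nat.factorial_succ]
  congr 1
  push_cast
  rw [Real.sqrt_mul (by positivity)]
  push_cast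
  rw [mul_inv, mul_inv_cancel_left₀ h1]

lemma lowerS_numS_succ (k : ℕ) : lowerS (numS (k + 1)) = ((√((k : ℝ) + 1) : ℝ) : ℂ) • numS k := by
  have h1 : ((√((k : ℝ) + 1) : ℝ) : ℂ) ≠ 0 :=
    Complex.ofReal_ne_zero.2 (Real.sqrt_pos.2 (by positivity)).ne'
  have h2 : ((√((k : ℝ) + 1) : ℝ) : ℂ) * ((√((k : ℝ) + 1) : ℝ) : ℂ) = (k : ℂ) + 1 := by
    rw [← Complex.ofReal_mul, Real.mul_self_sqrt (by positivity)]
    push_cast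
    rfl
  rw [numS, numS, map_smul, lowerS_pow, smul_smul, smul_smul, Nat.factorial_succ, ← h2]
  congr 1
  push_cast
  rw [Real.sqrt_mul (by positivity)]
  push_cast
  field_simp

lemma lowerS_numS_zero : lowerS (numS 0) = 0 := by
  simp [numS, lowerS_vacS]

lemma IsAnn.coeff {ψ φ : L2} (h : IsAnn ψ φ) (k : ℕ) :
    inner ℂ (numState k) φ = ((√((k : ℝ) + 1) : ℝ) : ℂ) * inner ℂ (numState (k + 1)) ψ := by
  rw [numState, ← h, raiseS_numS, map_smul, inner_smul_left, Complex.conj_ofReal, numState]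

lemma IsCre.coeff_succ {ψ χ : L2} (h : IsCre ψ χ) (k : ℕ) :
    inner ℂ (numState (k + 1)) χ = ((√((k : ℝ) + 1) : ℝ) : ℂ) * inner ℂ (numState k) ψ := by
  rw [numState, ← h _ _ (isAnn_incl _), lowerS_numS_succ, map_smul, inner_smul_left,
    Complex.conj_ofReal, numState]

lemma IsCre.coeff_zero {ψ χ : L2} (h : IsCre ψ χ) : inner ℂ (numState 0) χ = 0 := by
  rw [numState, ← h _ _ (isAnn_incl _), lowerS_numS_zero, map_zero, inner_zero_left]

lemma IsNum.coeff {ψ ν : L2} (h : IsNum ψ ν) (k : ℕ) :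
    inner ℂ (numState k) ν = k * inner ℂ (numState k) ψ := by
  obtain ⟨φ, ha, hc⟩ := h
  cases k with
  | zero => simp [hc.coeff_zero]
  | succ k =>
    rw [hc.coeff_succ, ha.coeff, ← mul_assoc, ← Complex.ofReal_mul,
      Real.mul_self_sqrt (by positivity)]
    push_cast
    rfl

/-- `D(a) ⊆ D(a†)`. -/
lemma IsAnn.exists_isCre {ψ φ : L2} (h : IsAnn ψ φ) : ∃ χ, IsCre ψ χ := by
  -- The coefficients that `a†ψ` must have. They are square summable because `Σ k|c_k|²` is
  -- controlled by `aψ` and `Σ |c_k|²` by `ψ`; Parseval then gives the adjoint relation against all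
  -- of `D(a)`.
  obtain ⟨c, c0, cs⟩ : ∃ c : ℕ → ℂ, c 0 = 0 ∧
      ∀ j, c (j + 1) = ((√((j : ℝ) + 1) : ℝ) : ℂ) * inner ℂ (numState j) ψ :=
    ⟨fun k => Nat.casesOn k 0 fun j => ((√((j : ℝ) + 1) : ℝ) : ℂ) * inner ℂ (numState j) ψ,
      rfl, fun _ => rfl⟩
  have hsq : ∀ j : ℕ, √((j : ℝ) + 1) ^ 2 = (j : ℝ) + 1 := fun j => Real.sq_sqrt (by positivity)
  have hs0 : Summable fun k : ℕ => (k : ℝ) * ‖inner ℂ (numState k) ψ‖ ^ 2 := by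
    rw [← summable_nat_add_iff 1]
    refine (hasSum_norm_sq_coeff φ).summable.congr fun k => ?_
    rw [h.coeff, norm_mul, mul_pow, Complex.norm_real, Real.norm_of_nonneg (Real.sqrt_nonneg _), hsq]
    push_cast
    rfl
  have hs : Summable fun k => ‖c k‖ ^ 2 := by
    rw [← summable_nat_add_iff 1]
    refine (hs0.add (hasSum_norm_sq_coeff ψ).summable).congr fun k => ?_
    simp only [cs, norm_mul, mul_pow, Complex.norm_real, Real.norm_of_nonneg (Real.sqrt_nonneg _), hsq]
    ring
  obtain ⟨χ, hχ⟩ := exists_coeff_eq hs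
  refine ⟨χ, fun η α hη => ?_⟩
  have h1 := numBasis.hasSum_inner_mul_inner α ψ
  have h2 := numBasis.hasSum_inner_mul_inner η χ
  rw [← hasSum_nat_add_iff' 1] at h2
  simp only [numBasis_apply, hχ, Finset.range_one, Finset.sum_singleton, c0, cs, mul_zero, sub_zero] at h1 h2
  refine h1.unique ?_
  convert! h2 using 2 with k
  rw [← inner_conj_symm, hη.coeff, map_mul, Complex.conj_ofReal, inner_conj_symm]
  ring

/-! ### The position operator -/

lemma coeFn_position {ψ φ χ : L2} (ha : IsAnn ψ φ) (hc : IsCre ψ χ) :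
    ∀ᵐ x : ℝ, (φ + χ : L2) x = ((√2 * x : ℝ) : ℂ) * ψ x := by
  have h2 : ((√2 : ℝ) : ℂ) * ((√2 : ℝ) : ℂ)⁻¹ = 1 :=
    mul_inv_cancel₀ (Complex.ofReal_ne_zero.2 (by positivity))
  have hpos : ∀ g : 𝓢(ℝ, ℂ), inner ℂ (incl g) (φ + χ) = ((√2 : ℝ) : ℂ) * inner ℂ (incl (posS g)) ψ := by
    intro g
    rw [inner_add_right, ← ha, ← hc _ _ (isAnn_incl g), posS_eq, LinearMap.smul_apply, map_smul,
      inner_smul_left, LinearMap.add_apply, map_add, inner_add_left, map_inv₀, Complex.conj_ofReal,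
      ← mul_assoc, h2, one_mul]
  have hl : LocallyIntegrable (fun x : ℝ => ((√2 * x : ℝ) : ℂ) * ψ x) := by
    have := ((Lp.memLp ψ).locallyIntegrable (by norm_num)).locallyIntegrableOn Set.univ
    rw [← locallyIntegrableOn_univ]
    exact this.continuousOn_mul (by fun_prop) isOpen_univ.isLocallyClosed
  have hl' : LocallyIntegrable (φ + χ : L2) volume := (Lp.memLp _).locallyIntegrable (by norm_num)
  have h0 := ae_eq_zero_of_integral_schwartz (hl'.sub hl) fun f => ?_
  · filter_upwards [h0] with x hx
    exact sub_eq_zero.1 hx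
  -- The inner product conjugates its first argument, so testing against `f` without conjugation
  -- uses `conjS f`.
  · have e := hpos (conjS f)
    rw [inner_incl_left, inner_incl_left, ← integral_const_mul] at e
    simp only [posS_apply, conjS_apply, map_mul, Complex.conj_conj, Complex.conj_ofReal] at e
    have i1 : Integrable fun x => f x * (φ + χ : L2) x := (f.memLp 2 volume).integrable_mul (Lp.memLp _)
    have i2 : Integrable fun x => f x * (((√2 * x : ℝ) : ℂ) * ψ x) := by
      refine ((((posS f).memLp 2 volume).integrable_mul (Lp.memLp ψ)).const_mul ((√2 : ℝ) : ℂ)).congr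
        (ae_of_all _ fun x => ?_)
      simp only [Pi.mul_apply, posS_apply]
      push_cast
      ring
    simp only [Pi.sub_apply, mul_sub]
    rw [integral_sub i1 i2, e, sub_eq_zero]
    refine integral_congr_ae (ae_of_all _ fun x => ?_)
    simp only
    push_cast
    ring

/-! ### Functions of the position operator -/

lemma ext_ae {φ ψ : L2} (h : ∀ᵐ x : ℝ, φ x = ψ x) : φ = ψ := Lp.ext h

lemma funX_mul (ω : ℝ) (f g : BoundedContinuousFunction ℝ ℂ) (ψ : L2) :
    funX ω (f * g) ψ = funX ω f (funX ω g ψ) := by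
  refine ext_ae ?_
  filter_upwards [coeFn_funX ω (f * g) ψ, coeFn_funX ω f (funX ω g ψ), coeFn_funX ω g ψ]
    with x h1 h2 h3
  rw [h1, h2, h3, BoundedContinuousFunction.mul_apply, mul_assoc]

lemma funX_smul (ω : ℝ) (c : ℂ) (f : BoundedContinuousFunction ℝ ℂ) (ψ : L2) :
    funX ω (c • f) ψ = c • funX ω f ψ := by
  refine ext_ae ?_
  filter_upwards [coeFn_funX ω (c • f) ψ, coeFn_funX ω f ψ, Lp.coeFn_smul c (funX ω f ψ)]
    with x h1 h2 h3
  rw [h1, h3, Pi.smul_apply, h2, smul_eq_mul, ← mul_assoc]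
  rfl

lemma inner_funX (ω : ℝ) (f : BoundedContinuousFunction ℝ ℂ) (φ ψ : L2) :
    inner ℂ φ (funX ω f ψ) = inner ℂ (funX ω (star f) φ) ψ := by
  rw [L2.inner_def, L2.inner_def]
  refine integral_congr_ae ?_
  filter_upwards [coeFn_funX ω f ψ, coeFn_funX ω (star f) φ] with x h1 h2
  rw [h1, h2]
  simp only [RCLike.inner_apply, BoundedContinuousFunction.star_apply, map_mul, Complex.star_def,
    Complex.conj_conj]
  ring

/-- `a f(X) = f(X) a + f'(X)/√(2ω)`. -/
lemma IsAnn.mulX {ψ φ : L2} (h : IsAnn ψ φ) (ω : ℝ) {f f' : BoundedContinuousFunction ℝ ℂ}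
    (hf : Function.HasTemperateGrowth f) (hd : ∀ x, HasDerivAt f (f' x) x) :
    IsAnn (funX ω f ψ) (funX ω f φ + ((√(2 * ω) : ℝ) : ℂ)⁻¹ • funX ω f' ψ) := by
  intro g
  have ht : Function.HasTemperateGrowth fun x : ℝ => star (f (x / √ω)) := by
    have h1 : Function.HasTemperateGrowth fun x : ℝ => x / √ω := by
      simp only [div_eq_mul_inv]; fun_prop
    exact Complex.conjCLE.toContinuousLinearMap.hasTemperateGrowth.comp (hf.comp h1)
  -- Multiplication by `f(X)` is moved onto the test function. Temperate growth of `f` keeps the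
  -- product Schwartz, and the Leibniz rule in `raiseS` produces the `f'` term.
  let G : 𝓢(ℝ, ℂ) := SchwartzMap.smulLeftCLM ℂ (fun x : ℝ => star (f (x / √ω))) g
  have hG : ∀ x, G x = star (f (x / √ω)) * g x := fun x => by
    exact SchwartzMap.smulLeftCLM_apply_apply ht g x
  have hdG : ∀ x, deriv G x = star (f' (x / √ω) / √ω) * g x + star (f (x / √ω)) * deriv g x := by
    intro x
    have h1 : HasDerivAt (fun x : ℝ => f (x / √ω)) (f' (x / √ω) / √ω) x := by
      have := (hd (x / √ω)).scomp x ((hasDerivAt_id x).div_const (√ω))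
      convert! this using 1
      simp [div_eq_inv_mul]
    have h2 := (h1.star).mul (g.hasDerivAt x)
    have h3 : (G : ℝ → ℂ) = fun x => star (f (x / √ω)) * g x := funext hG
    rw [h3]
    exact h2.deriv
  have e1 : funX ω (star f) (incl (raiseS g)) =
      incl (raiseS G) + ((√(2 * ω) : ℝ) : ℂ)⁻¹ • funX ω (star f') (incl g) := by
    refine ext_ae ?_
    filter_upwards [coeFn_funX ω (star f) (incl (raiseS g)), coeFn_funX ω (star f') (incl g),
      (raiseS g).coeFn_toLp 2 volume, (raiseS G).coeFn_toLp 2 volume, g.coeFn_toLp 2 volume,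
      Lp.coeFn_add (incl (raiseS G)) (((√(2 * ω) : ℝ) : ℂ)⁻¹ • funX ω (star f') (incl g)),
      Lp.coeFn_smul ((√(2 * ω) : ℝ) : ℂ)⁻¹ (funX ω (star f') (incl g))] with x h1 h2 h3 h4 h5 h6 h7
    rw [h1, h6, Pi.add_apply, h7, Pi.smul_apply, h2]
    simp only [incl_apply, h3, h4, h5, raiseS_apply, hG, hdG, BoundedContinuousFunction.star_apply,
      smul_eq_mul]
    rw [Real.sqrt_mul (by norm_num)]
    simp only [Complex.star_def, map_div₀, Complex.conj_ofReal]
    push_cast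
    rw [mul_inv]
    ring
  have e2 : incl G = funX ω (star f) (incl g) := by
    refine ext_ae ?_
    filter_upwards [coeFn_funX ω (star f) (incl g), G.coeFn_toLp 2 volume, g.coeFn_toLp 2 volume]
      with x h1 h2 h3
    rw [h1]
    simp only [incl_apply, h2, h3, hG, BoundedContinuousFunction.star_apply]
  rw [inner_funX, e1, inner_add_left, h, e2, ← inner_funX, inner_smul_left, ← inner_funX,
    inner_add_right, inner_smul_right, map_inv₀, Complex.conj_ofReal]

/-- `a† f(X) = f(X) a† - f'(X)/√(2ω)`. -/
lemma IsCre.mulX {ψ χ : L2} (h : IsCre ψ χ) (ω : ℝ) {f f' : BoundedContinuousFunction ℝ ℂ}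
    (hf : Function.HasTemperateGrowth f) (hd : ∀ x, HasDerivAt f (f' x) x) :
    IsCre (funX ω f ψ) (funX ω f χ - ((√(2 * ω) : ℝ) : ℂ)⁻¹ • funX ω f' ψ) := by
  intro φ α hα
  have ht : Function.HasTemperateGrowth (star f) :=
    Complex.conjCLE.toContinuousLinearMap.hasTemperateGrowth.comp hf
  have hd' : ∀ x, HasDerivAt ⇑(star f) ((star f') x) x := fun x => HasDerivAt.star (hd x)
  -- The creation rule is the adjoint of the annihilation rule for the conjugate function.
  have h1 := hα.mulX ω (f := star f) ht hd'
  have h2 := h _ _ h1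
  rw [inner_funX, inner_sub_right, inner_funX, ← h2, inner_smul_right, inner_funX, inner_add_left,
    inner_smul_left, map_inv₀, Complex.conj_ofReal, add_sub_cancel_right]

/-! ### Conjugation of the number operator by a kick -/

lemma hasTemperateGrowth_exp_mul_I :
    Function.HasTemperateGrowth fun y : ℝ => Complex.exp (y * Complex.I) := by
  refine ⟨(Complex.ofRealCLM.contDiff.mul contDiff_const).cexp, fun n => ⟨0, 1, fun x => ?_⟩⟩
  have h : ∀ n, iteratedDeriv n (fun y : ℝ => Complex.exp (y * Complex.I)) =
      fun y : ℝ => Complex.I ^ n * Complex.exp (y * Complex.I) := by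
    intro n
    induction n with
    | zero => simp
    | succ n ih =>
      rw [iteratedDeriv_succ, ih]
      funext y
      have h1 : HasDerivAt (fun y : ℝ => (y : ℂ) * Complex.I) (1 * Complex.I) y :=
        (Complex.ofRealCLM.hasDerivAt (x := y)).mul_const _
      rw [(h1.cexp.const_mul (Complex.I ^ n)).deriv]
      ring
  rw [norm_iteratedFDeriv_eq_norm_iteratedDeriv, h]
  simp [Complex.norm_exp_ofReal_mul_I]

lemma hasTemperateGrowth_sinB : Function.HasTemperateGrowth sinB := by
  have h : (sinB : ℝ → ℂ) = fun x : ℝ =>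
      (Complex.ofRealCLM.comp Complex.imCLM) (Complex.exp (x * Complex.I)) := by
    funext x
    simp [sinB, Complex.exp_ofReal_mul_I_im]
  rw [h]
  exact (ContinuousLinearMap.hasTemperateGrowth _).comp hasTemperateGrowth_exp_mul_I

lemma hasTemperateGrowth_kickB (K : ℝ) : Function.HasTemperateGrowth (kickB K) := by
  have h : (fun x : ℝ => -(K * Real.cos x)) = fun x : ℝ =>
      ((-K) • Complex.reCLM) (Complex.exp (x * Complex.I)) := by
    funext x
    simp [Complex.exp_ofReal_mul_I_re]
  have h1 : Function.HasTemperateGrowth (fun x : ℝ => -(K * Real.cos x)) := by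
    rw [h]
    exact (ContinuousLinearMap.hasTemperateGrowth _).comp hasTemperateGrowth_exp_mul_I
  exact hasTemperateGrowth_exp_mul_I.comp h1

/-- The function `cos`. -/
def cosB : BoundedContinuousFunction ℝ ℂ :=
  BoundedContinuousFunction.ofNormedAddCommGroup (fun x : ℝ => ((Real.cos x : ℝ) : ℂ))
    (by fun_prop) 1 (fun x => by simpa [← Complex.ofReal_cos] using Real.abs_cos_le_one x)

lemma sinB_apply (x : ℝ) : sinB x = ((Real.sin x : ℝ) : ℂ) := rfl

lemma kickB_apply (K x : ℝ) :
    kickB K x = Complex.exp (((-(K * Real.cos x) : ℝ) : ℂ) * Complex.I) := rfl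

lemma hasDerivAt_sinB (x : ℝ) : HasDerivAt sinB (cosB x) x := (Real.hasDerivAt_sin x).ofReal_comp

lemma hasDerivAt_kickB (K x : ℝ) :
    HasDerivAt (kickB K) (((Complex.I * K) • (sinB * kickB K)) x) x := by
  have h1 : HasDerivAt (fun x : ℝ => -(K * Real.cos x)) (-(K * -Real.sin x)) x :=
    ((Real.hasDerivAt_cos x).const_mul K).neg
  have h2 := (h1.ofReal_comp.mul_const Complex.I).cexp
  convert! h2 using 1
  simp only [BoundedContinuousFunction.coe_smul, BoundedContinuousFunction.mul_apply, smul_eq_mul,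
    sinB_apply, kickB_apply]
  push_cast
  ring

lemma kickB_add (K K' : ℝ) : kickB (K + K') = kickB K * kickB K' := by
  ext x
  simp only [BoundedContinuousFunction.mul_apply, kickB_apply, ← Complex.exp_add]
  congr 1
  push_cast
  ring

lemma kickB_zero : kickB 0 = 1 := by
  ext x
  simp [kickB_apply]

lemma star_kickB (K : ℝ) : star (kickB K) = kickB (-K) := by
  ext x
  simp [kickB_apply, ← Complex.exp_conj, ← Complex.cos_conj]

lemma funX_one (ω : ℝ) (ψ : L2) : funX ω 1 ψ = ψ := by
  refine ext_ae ?_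
  filter_upwards [coeFn_funX ω 1 ψ] with x h
  rw [h, BoundedContinuousFunction.coe_one, Pi.one_apply, one_mul]

lemma kick_pow (K ω : ℝ) (n : ℕ) (ψ : L2) : (kick K ω ^ n) ψ = kick (n * K) ω ψ := by
  induction n with
  | zero => simp [kick, kickB_zero, funX_one]
  | succ n ih =>
    rw [pow_succ', mul_apply_eq_comp, ih, kick, kick, ← funX_mul, ← kickB_add, kick,
      show K + n * K = ((n + 1 : ℕ) : ℝ) * K by push_cast; ring]

lemma inner_kick (K ω : ℝ) (φ ψ : L2) : inner ℂ (kick K ω φ) (kick K ω ψ) = inner ℂ φ ψ := by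
  rw [kick, inner_funX, star_kickB, ← funX_mul, ← kickB_add, neg_add_cancel, kickB_zero, funX_one]

lemma norm_kick (K ω : ℝ) (ψ : L2) : ‖kick K ω ψ‖ = ‖ψ‖ := by
  rw [@norm_eq_sqrt_re_inner ℂ, inner_kick, ← norm_eq_sqrt_re_inner]

lemma IsAnn.kick {ψ φ : L2} (h : IsAnn ψ φ) (K ω : ℝ) :
    IsAnn (kick K ω ψ)
      (kick K ω (φ + (Complex.I * ((K / √(2 * ω) : ℝ) : ℂ)) • sinX ω ψ)) := by
  have := h.mulX ω (hasTemperateGrowth_kickB K) (hasDerivAt_kickB K)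
  convert! this using 1
  rw [funX_smul, mul_comm sinB, funX_mul, smul_smul, map_add, map_smul, KHO.kick, sinX]
  congr 2
  push_cast
  ring

lemma IsCre.kick {ψ χ : L2} (h : IsCre ψ χ) (K ω : ℝ) :
    IsCre (kick K ω ψ)
      (kick K ω (χ - (Complex.I * ((K / √(2 * ω) : ℝ) : ℂ)) • sinX ω ψ)) := by
  have := h.mulX ω (hasTemperateGrowth_kickB K) (hasDerivAt_kickB K)
  convert! this using 1
  rw [funX_smul, mul_comm sinB, funX_mul, smul_smul, map_sub, map_smul, KHO.kick, sinX]
  congr 2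
  push_cast
  ring

/-- Apply the two kick rules in turn: `a` shifts by `iκ sin X` and `a†` by `-iκ sin X`, with `κ =
K/√(2ω)`. The product of the shifts is `κ² sin² X`. The relation `hη` is needed because `a†` meets
the term `sin X ψ` created by `a`. -/
lemma IsNum.kick {ψ φ ν η : L2} (ha : IsAnn ψ φ) (hc : IsCre φ ν) (ω : ℝ)
    (hη : IsCre (sinX ω ψ) η) (K : ℝ) :
    IsNum (kick K ω ψ) (kick K ω (ν
      - (Complex.I * ((K / √(2 * ω) : ℝ) : ℂ)) • (sinX ω φ - η)
      + (((K / √(2 * ω) : ℝ) : ℂ) ^ 2) • sinX ω (sinX ω ψ))) := by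
  refine ⟨_, ha.kick K ω, ?_⟩
  have h := (hc.add (hη.smul (Complex.I * ((K / √(2 * ω) : ℝ) : ℂ)))).kick K ω
  generalize ((K / √(2 * ω) : ℝ) : ℂ) = κ at h ⊢
  convert! h using 2
  have hI : Complex.I * κ * (Complex.I * κ) = -κ ^ 2 := by
    linear_combination κ ^ 2 * Complex.I_mul_I
  simp only [map_add, map_smul, smul_add, smul_sub, smul_smul, hI, neg_smul]
  abel

/-! ### Parity -/

/-- The reflection `x ↦ -x` on Schwartz functions. -/
def reflS : 𝓢(ℝ, ℂ) →ₗ[ℂ] 𝓢(ℝ, ℂ) :=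
  (SchwartzMap.compCLMOfContinuousLinearEquiv ℂ (ContinuousLinearEquiv.neg ℝ)).toLinearMap

lemma reflS_apply (f : 𝓢(ℝ, ℂ)) (x : ℝ) : reflS f x = f (-x) := rfl

/-- The parity operator. -/
def parity : L2 →ₗᵢ[ℂ] L2 :=
  Lp.compMeasurePreservingₗᵢ ℂ (fun x : ℝ => -x) (Measure.measurePreserving_neg volume)

lemma coeFn_parity (ψ : L2) : ∀ᵐ x : ℝ, parity ψ x = ψ (-x) :=
  Lp.coeFn_compMeasurePreserving ψ (Measure.measurePreserving_neg volume)

lemma ae_neg {p : ℝ → Prop} (h : ∀ᵐ x : ℝ, p x) : ∀ᵐ x : ℝ, p (-x) :=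
  (Measure.measurePreserving_neg (volume : Measure ℝ)).quasiMeasurePreserving.ae h

lemma parity_parity (ψ : L2) : parity (parity ψ) = ψ := by
  refine ext_ae ?_
  filter_upwards [coeFn_parity (parity ψ), ae_neg (coeFn_parity ψ)] with x h1 h2
  rw [h1, h2, neg_neg]

lemma inner_parity (φ ψ : L2) : inner ℂ φ (parity ψ) = inner ℂ (parity φ) ψ := by
  rw [← parity.inner_map_map φ, parity_parity]

lemma parity_incl (f : 𝓢(ℝ, ℂ)) : parity (incl f) = incl (reflS f) := by
  refine ext_ae ?_
  filter_upwards [coeFn_parity (incl f), ae_neg (f.coeFn_toLp 2 volume),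
    (reflS f).coeFn_toLp 2 volume] with x h1 h2 h3
  rw [h1, incl_apply, h2, incl_apply, h3, reflS_apply]

lemma reflS_raiseS (f : 𝓢(ℝ, ℂ)) : reflS (raiseS f) = -raiseS (reflS f) := by
  ext x
  have h : HasDerivAt (reflS f) (-deriv f (-x)) x := by
    have := (f.hasDerivAt (-x)).scomp x (hasDerivAt_neg x)
    convert! this using 1
    simp
  have h' : deriv (reflS f : ℝ → ℂ) x = -deriv f (-x) := h.deriv
  rw [reflS_apply, neg_apply, raiseS_apply, raiseS_apply, h', reflS_apply]
  push_cast
  ring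

lemma parity_funX (ω : ℝ) {f : BoundedContinuousFunction ℝ ℂ} (hf : ∀ x, f (-x) = f x) (ψ : L2) :
    parity (funX ω f ψ) = funX ω f (parity ψ) := by
  refine ext_ae ?_
  filter_upwards [coeFn_parity (funX ω f ψ), ae_neg (coeFn_funX ω f ψ), coeFn_funX ω f (parity ψ),
    coeFn_parity ψ] with x h1 h2 h3 h4
  rw [h1, h2, h3, h4, neg_div, hf]

lemma parity_kick (K ω : ℝ) (ψ : L2) : parity (kick K ω ψ) = kick K ω (parity ψ) :=
  parity_funX ω (fun x => by simp [kickB_apply]) ψ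

lemma IsAnn.parity {ψ φ : L2} (h : IsAnn ψ φ) : IsAnn (parity ψ) (-parity φ) := fun g => by
  rw [inner_parity, parity_incl, reflS_raiseS, map_neg, inner_neg_left, h, ← parity_incl,
    ← inner_parity, inner_neg_right]

lemma IsCre.parity {ψ χ : L2} (h : IsCre ψ χ) : IsCre (parity ψ) (-parity χ) := fun φ α hα => by
  rw [inner_parity, inner_neg_right, inner_parity, ← h _ _ hα.parity, inner_neg_left, neg_neg]

lemma IsNum.parity {ψ ν : L2} (h : IsNum ψ ν) : IsNum (parity ψ) (parity ν) := by
  obtain ⟨φ, ha, hc⟩ := h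
  refine ⟨_, ha.parity, ?_⟩
  have := hc.parity.smul (-1)
  simpa using this

lemma parity_numState (k : ℕ) : parity (numState k) = (-1 : ℂ) ^ k • numState k := by
  have hv : reflS vacS = vacS := by
    ext x
    simp [reflS_apply, vacS_apply]
  have h : ∀ k, reflS ((raiseS ^ k) vacS) = (-1 : ℂ) ^ k • (raiseS ^ k) vacS := by
    intro k
    induction k with
    | zero => simp [hv]
    | succ k ih =>
      rw [pow_succ' raiseS, Module.End.mul_apply, reflS_raiseS, ih, map_smul, pow_succ']
      simp
  rw [numState, parity_incl, numS, map_smul, h, smul_comm, map_smul]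

/-! ### The free evolution -/

lemma coeff_rotation (θ : ℝ) (ψ : L2) (k : ℕ) :
    inner ℂ (numState k) (rotation θ ψ) =
      Complex.exp (-(Complex.I * θ * k)) * inner ℂ (numState k) ψ := by
  have h := (hasSum_rotation θ ψ).mapL (innerSL ℂ (numState k))
  refine h.unique ?_
  have hs := hasSum_single (f := fun j : ℕ => (innerSL ℂ (numState k))
    ((Complex.exp (-(Complex.I * θ * j)) * inner ℂ (numState j) ψ) • numState j)) k fun j hj => by
      rw [innerSL_apply_apply, inner_smul_right, orthonormal_numState.2 hj.symm, mul_zero]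
  convert! hs using 1
  rw [innerSL_apply_apply, inner_smul_right, inner_self_eq_norm_sq_to_K, orthonormal_numState.1 k]
  simp

lemma norm_exp_phase (θ : ℝ) (k : ℕ) : ‖Complex.exp (-(Complex.I * θ * k))‖ = 1 := by
  rw [show -(Complex.I * θ * k) = ((-(θ * k) : ℝ) : ℂ) * Complex.I by push_cast; ring,
    Complex.norm_exp_ofReal_mul_I]

lemma norm_rotation (θ : ℝ) (ψ : L2) : ‖rotation θ ψ‖ = ‖ψ‖ := by
  have h1 := hasSum_norm_sq_coeff (rotation θ ψ)
  simp only [coeff_rotation, norm_mul, norm_exp_phase, one_mul] at h1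
  have := h1.unique (hasSum_norm_sq_coeff ψ)
  exact (sq_eq_sq₀ (norm_nonneg _) (norm_nonneg _)).1 this

lemma rotation_pi (ψ : L2) : rotation Real.pi ψ = parity ψ := by
  refine ext_coeff fun k => ?_
  rw [coeff_rotation, inner_parity, parity_numState, inner_smul_left]
  congr 1
  rw [show -(Complex.I * Real.pi * k) = (k : ℂ) * (-(Real.pi * Complex.I)) by ring,
    Complex.exp_nat_mul, Complex.exp_neg, Complex.exp_pi_mul_I]
  simp

/-- By Parseval, norm convergence is dominated convergence for the series of squared coefficients.
-/
lemma tendsto_zero_of_coeff {l : Filter ℝ} [l.IsCountablyGenerated] {y : ℝ → L2} {β : ℕ → ℝ}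
    (hβ : Summable β) (hb : ∀ᶠ w in l, ∀ k, ‖inner ℂ (numState k) (y w)‖ ^ 2 ≤ β k)
    (ht : ∀ k, Tendsto (fun w => inner ℂ (numState k) (y w)) l (𝓝 0)) : Tendsto y l (𝓝 0) := by
  have h := tendsto_tsum_of_dominated_convergence (𝓕 := l)
    (f := fun w k => ‖inner ℂ (numState k) (y w)‖ ^ 2) (g := fun _ => (0 : ℝ)) hβ
    (fun k => by simpa using ((ht k).norm).pow 2)
    (hb.mono fun w hw k => by rw [Real.norm_of_nonneg (sq_nonneg _)]; exact hw k)
  simp only [(hasSum_norm_sq_coeff _).tsum_eq, tsum_zero] at h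
  rw [tendsto_zero_iff_norm_tendsto_zero]
  have h2 := h.sqrt
  simpa [Real.sqrt_sq (norm_nonneg _)] using h2

lemma tendsto_rotation (θ : ℝ) (ψ : L2) :
    Tendsto (fun w => rotation w ψ) (𝓝 θ) (𝓝 (rotation θ ψ)) := by
  rw [tendsto_sub_nhds_zero_iff.symm]
  refine tendsto_zero_of_coeff (β := fun k => 4 * ‖inner ℂ (numState k) ψ‖ ^ 2)
    ((hasSum_norm_sq_coeff ψ).summable.mul_left 4) (Eventually.of_forall fun w k => ?_) fun k => ?_
  · rw [inner_sub_right, coeff_rotation, coeff_rotation, ← sub_mul, norm_mul, mul_pow]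
    have := norm_sub_le (Complex.exp (-(Complex.I * w * k))) (Complex.exp (-(Complex.I * θ * k)))
    rw [norm_exp_phase, norm_exp_phase] at this
    gcongr
    nlinarith [norm_nonneg (Complex.exp (-(Complex.I * w * k)) - Complex.exp (-(Complex.I * θ * k)))]
  · simp only [inner_sub_right, coeff_rotation]
    have hc : Continuous fun w : ℝ => Complex.exp (-(Complex.I * w * k)) * inner ℂ (numState k) ψ -
      Complex.exp (-(Complex.I * θ * k)) * inner ℂ (numState k) ψ := by fun_prop
    simpa using hc.tendsto θ

lemma norm_exp_phase_sub_le (w θ : ℝ) (k : ℕ) :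
    ‖Complex.exp (-(Complex.I * w * k)) - Complex.exp (-(Complex.I * θ * k))‖ ≤ k * |w - θ| := by
  have h : Complex.exp (-(Complex.I * w * k)) - Complex.exp (-(Complex.I * θ * k)) =
      Complex.exp (-(Complex.I * θ * k)) *
        (Complex.exp (Complex.I * ((-(k * (w - θ)) : ℝ) : ℂ)) - 1) := by
    rw [mul_sub, ← Complex.exp_add, mul_one]
    congr 2
    push_cast
    ring
  rw [h, norm_mul, norm_exp_phase, one_mul]
  refine (Real.norm_exp_I_mul_ofReal_sub_one_le).trans ?_
  simp

/-- The difference quotient of the `k`th phase and its limit are each at most `k` in modulus. The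
squared error is thus at most `4k²|⟨k|ψ⟩|² = 4|⟨k|ν⟩|²`, summable exactly because `ψ ∈ D(a†a)`. -/
lemma hasDerivAt_rotation {ψ ν : L2} (h : IsNum ψ ν) (θ : ℝ) :
    HasDerivAt (fun w => rotation w ψ) (-Complex.I • rotation θ ν) θ := by
  rw [hasDerivAt_iff_tendsto_slope, tendsto_sub_nhds_zero_iff.symm]
  have hcoeff : ∀ (w : ℝ) (k : ℕ), inner ℂ (numState k)
      (slope (fun w => rotation w ψ) θ w - -Complex.I • rotation θ ν) =
      (slope (fun w : ℝ => Complex.exp (-(Complex.I * w * k))) θ w -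
        (-(Complex.I * k) * Complex.exp (-(Complex.I * θ * k)))) * inner ℂ (numState k) ψ := by
    intro w k
    rw [inner_sub_right, slope_def_module, slope_def_module, inner_smul_right_eq_smul,
      inner_sub_right, inner_smul_right, coeff_rotation, coeff_rotation, coeff_rotation, h.coeff,
      Complex.real_smul, Complex.real_smul]
    ring
  refine tendsto_zero_of_coeff (β := fun k => 4 * ‖inner ℂ (numState k) ν‖ ^ 2)
    ((hasSum_norm_sq_coeff ν).summable.mul_left 4) ?_ fun k => ?_
  · filter_upwards [self_mem_nhdsWithin] with w hw k
    have hw' : 0 < |w - θ| := abs_pos.2 (sub_ne_zero.2 hw)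
    rw [hcoeff, h.coeff, norm_mul, norm_mul, mul_pow, mul_pow, ← mul_assoc]
    have h1 : ‖slope (fun w : ℝ => Complex.exp (-(Complex.I * w * k))) θ w‖ ≤ k := by
      rw [slope_def_module, norm_smul, norm_inv, Real.norm_eq_abs, inv_mul_le_iff₀ hw', mul_comm _ (k : ℝ)]
      exact norm_exp_phase_sub_le w θ k
    have h2 : ‖-(Complex.I * k) * Complex.exp (-(Complex.I * θ * k))‖ = k := by
      rw [norm_mul, norm_exp_phase]
      simp
    have h3 := norm_sub_le (slope (fun w : ℝ => Complex.exp (-(Complex.I * w * k))) θ w)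
      (-(Complex.I * k) * Complex.exp (-(Complex.I * θ * k)))
    rw [h2] at h3
    have h4 : ‖(k : ℂ)‖ = k := by simp
    rw [h4]
    gcongr
    have h5 := h3.trans (add_le_add_left h1 _)
    nlinarith [norm_nonneg (slope (fun w : ℝ => Complex.exp (-(Complex.I * w * k))) θ w -
      -(Complex.I * k) * Complex.exp (-(Complex.I * θ * k)))]
  · simp only [hcoeff]
    have h1 : HasDerivAt (fun w : ℝ => -(Complex.I * (w : ℂ) * k)) (-(Complex.I * 1 * k)) θ :=
      (((Complex.ofRealCLM.hasDerivAt (x := θ)).const_mul Complex.I).mul_const (k : ℂ)).neg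
    have h2 := hasDerivAt_iff_tendsto_slope.1 h1.cexp
    have h3 := (h2.sub_const
      (-(Complex.I * k) * Complex.exp (-(Complex.I * θ * k)))).mul_const (inner ℂ (numState k) ψ)
    convert h3 using 2
    ring

/-! ### Frequency dependence of the kick -/

lemma norm_sq_eq_integral (ψ : L2) : ‖ψ‖ ^ 2 = ∫ x, ‖ψ x‖ ^ 2 := by
  have h := inner_self_eq_norm_sq_to_K (𝕜 := ℂ) ψ
  rw [L2.inner_def] at h
  have h2 : ∀ x, inner ℂ (ψ x) (ψ x) = ((‖ψ x‖ ^ 2 : ℝ) : ℂ) := fun x => by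
    rw [inner_self_eq_norm_sq_to_K]
    norm_cast
  simp only [h2, integral_complex_ofReal] at h
  have h3 : ((∫ x, ‖ψ x‖ ^ 2 : ℝ) : ℂ) = ((‖ψ‖ ^ 2 : ℝ) : ℂ) := by
    rw [h]
    norm_cast
  exact (Complex.ofReal_injective h3).symm

lemma tendsto_zero_of_dominated {l : Filter ℝ} [l.IsCountablyGenerated] {y : ℝ → L2}
    {f : ℝ → ℝ → ℂ} {b : ℝ → ℝ} (hy : ∀ w, ∀ᵐ x, y w x = f w x) (hb : MemLp b 2 volume)
    (hfb : ∀ᶠ w in l, ∀ᵐ x, ‖f w x‖ ≤ b x) (ht : ∀ᵐ x, Tendsto (fun w => f w x) l (𝓝 0)) :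
    Tendsto y l (𝓝 0) := by
  have hn : ∀ w, ‖y w‖ ^ 2 = ∫ x, ‖f w x‖ ^ 2 := fun w => by
    rw [norm_sq_eq_integral]
    refine integral_congr_ae ?_
    filter_upwards [hy w] with x hx
    rw [hx]
  have h := tendsto_integral_filter_of_dominated_convergence (μ := (volume : Measure ℝ)) (l := l)
    (F := fun w x => ‖f w x‖ ^ 2) (f := fun _ => (0 : ℝ)) (fun x => b x ^ 2)
    (Eventually.of_forall fun w =>
      (((Lp.aestronglyMeasurable (y w)).congr (hy w)).norm.pow 2)) ?_ hb.integrable_sq ?_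
  · simp only [← hn, integral_zero] at h
    rw [tendsto_zero_iff_norm_tendsto_zero]
    simpa [Real.sqrt_sq (norm_nonneg _)] using h.sqrt
  · filter_upwards [hfb] with w hw
    filter_upwards [hw] with x h1
    rw [Real.norm_of_nonneg (sq_nonneg _)]
    gcongr
  · filter_upwards [ht] with x hx
    simpa using hx.norm.pow 2

lemma hasDerivAt_inv_sqrt {ω : ℝ} (hω : 0 < ω) :
    HasDerivAt (fun w : ℝ => (√w)⁻¹) (-(1 / (2 * ω)) * (√ω)⁻¹) ω := by
  have h := (Real.hasDerivAt_sqrt hω.ne').inv (Real.sqrt_pos.2 hω).ne'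
  convert! h using 1
  rw [Real.sq_sqrt hω.le]
  field_simp

lemma hasDerivAt_kickB_div_sqrt (K : ℝ) {ω : ℝ} (hω : 0 < ω) (x : ℝ) :
    HasDerivAt (fun w : ℝ => kickB K (x / √w))
      (-(Complex.I * K / (2 * ω)) * ((x / √ω : ℝ) * (sinB (x / √ω) * kickB K (x / √ω)))) ω := by
  have h := (hasDerivAt_kickB K (x / √ω)).scomp ω ((hasDerivAt_inv_sqrt hω).const_mul x)
  convert! h using 1
  simp only [BoundedContinuousFunction.coe_smul, BoundedContinuousFunction.mul_apply, smul_eq_mul,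
    Complex.real_smul]
  push_cast
  ring

lemma norm_kickB (K s : ℝ) : ‖kickB K s‖ = 1 := by
  rw [kickB_apply, Complex.norm_exp_ofReal_mul_I]

lemma norm_kickB_sub_le (K s s' : ℝ) : ‖kickB K s - kickB K s'‖ ≤ |K| * |s - s'| := by
  have h : kickB K s - kickB K s' = kickB K s' *
      (Complex.exp (Complex.I * ((-(K * (Real.cos s - Real.cos s')) : ℝ) : ℂ)) - 1) := by
    rw [mul_sub, mul_one, kickB_apply, kickB_apply, ← Complex.exp_add]
    congr 2
    push_cast
    ring
  rw [h, norm_mul, norm_kickB, one_mul]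
  refine (Real.norm_exp_I_mul_ofReal_sub_one_le).trans ?_
  rw [norm_neg, Real.norm_eq_abs, abs_mul]
  exact mul_le_mul_of_nonneg_left (Real.abs_cos_sub_cos_le s s') (abs_nonneg _)

lemma tendsto_kick (K : ℝ) {ω : ℝ} (hω : 0 < ω) (ψ : L2) :
    Tendsto (fun w => kick K w ψ) (𝓝 ω) (𝓝 (kick K ω ψ)) := by
  rw [tendsto_sub_nhds_zero_iff.symm]
  refine tendsto_zero_of_dominated (b := fun x => 2 * ‖ψ x‖)
    (f := fun w x => (kickB K (x / √w) - kickB K (x / √ω)) * ψ x) (fun w => ?_)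
    ((Lp.memLp ψ).norm.const_mul 2) (Eventually.of_forall fun w => ae_of_all _ fun x => ?_)
    (ae_of_all _ fun x => ?_)
  · filter_upwards [coeFn_funX w (kickB K) ψ, coeFn_funX ω (kickB K) ψ,
      Lp.coeFn_sub (kick K w ψ) (kick K ω ψ)] with x h1 h2 h3
    rw [h3, Pi.sub_apply, kick, kick, h1, h2, sub_mul]
  · rw [norm_mul]
    gcongr
    refine (norm_sub_le _ _).trans ?_
    rw [norm_kickB, norm_kickB]
    norm_num
  · have := (((hasDerivAt_kickB_div_sqrt K hω x).continuousAt.tendsto.sub_const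
      (kickB K (x / √ω))).mul_const (ψ x))
    simpa using this

/-- The phase is Lipschitz in `x/√w`, so the pointwise difference quotient is at most a constant
times `|x|`. The vector `ξ = xψ ∈ L²` serves as the dominating function. -/
lemma hasDerivAt_kick (K : ℝ) {ω : ℝ} (hω : 0 < ω) {ψ ξ θ : L2} (hξ : ∀ᵐ x : ℝ, ξ x = x * ψ x)
    (hθ : ∀ᵐ x : ℝ, θ x = (x / √ω : ℝ) * (sinB (x / √ω) * ψ x)) :
    HasDerivAt (fun w => kick K w ψ) (-(Complex.I * K / (2 * ω)) • kick K ω θ) ω := by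
  rw [hasDerivAt_iff_tendsto_slope, tendsto_sub_nhds_zero_iff.symm]
  -- `C` is a Lipschitz constant of `w ↦ 1/√w` at `ω`, valid for `w` near `ω`.
  obtain ⟨C, hC⟩ := (hasDerivAt_inv_sqrt hω).isBigO_sub.bound
  set d : ℝ → ℂ := fun x =>
    -(Complex.I * K / (2 * ω)) * ((x / √ω : ℝ) * (sinB (x / √ω) * kickB K (x / √ω))) with hd
  have hdb : ∀ x, ‖d x‖ ≤ |K| / (2 * ω) / √ω * |x| := by
    intro x
    have hs : ‖sinB (x / √ω)‖ ≤ 1 := by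
      rw [sinB_apply, Complex.norm_real]
      exact Real.abs_sin_le_one _
    simp only [hd, norm_mul, norm_neg, norm_div, norm_kickB, Complex.norm_I, Complex.norm_real,
      mul_one, one_mul, Real.norm_eq_abs, abs_of_pos hω, abs_of_nonneg (Real.sqrt_nonneg ω),
      Complex.norm_ofNat]
    calc _ ≤ |K| / (2 * ω) * (|x| / √ω * 1) := by gcongr
      _ = _ := by ring
  refine tendsto_zero_of_dominated
    (b := fun x => (|K| * C + |K| / (2 * ω) / √ω) * ‖ξ x‖)
    (f := fun w x => (slope (fun w : ℝ => kickB K (x / √w)) ω w - d x) * ψ x) (fun w => ?_)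
    ((Lp.memLp ξ).norm.const_mul _) ?_ (ae_of_all _ fun x => ?_)
  · filter_upwards [coeFn_funX w (kickB K) ψ, coeFn_funX ω (kickB K) ψ, coeFn_funX ω (kickB K) θ, hθ,
      Lp.coeFn_sub (slope (fun w => kick K w ψ) ω w) (-(Complex.I * K / (2 * ω)) • kick K ω θ),
      Lp.coeFn_smul (-(Complex.I * K / (2 * ω))) (kick K ω θ),
      Lp.coeFn_smul ((w - ω)⁻¹) (kick K w ψ - kick K ω ψ),
      Lp.coeFn_sub (kick K w ψ) (kick K ω ψ)] with x h1 h2 h3 h4 h5 h6 h7 h8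
    rw [h5, Pi.sub_apply, h6, Pi.smul_apply, slope_def_module, h7, Pi.smul_apply, h8, Pi.sub_apply,
      kick, kick, h1, h2, h3, h4, slope_def_module, Complex.real_smul, Complex.real_smul, smul_eq_mul]
    simp only [hd]
    ring
  · have hC' := hC.filter_mono (nhdsWithin_le_nhds (s := {ω}ᶜ))
    filter_upwards [hC', self_mem_nhdsWithin] with w hw hne
    have hw' : 0 < |w - ω| := abs_pos.2 (sub_ne_zero.2 hne)
    filter_upwards [hξ] with x hx
    rw [hx, norm_mul, norm_mul, ← mul_assoc, Complex.norm_real, Real.norm_eq_abs]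
    gcongr
    refine (norm_sub_le _ _).trans ?_
    rw [add_mul]
    refine add_le_add ?_ (hdb x)
    rw [slope_def_module, norm_smul, norm_inv, Real.norm_eq_abs, inv_mul_le_iff₀ hw']
    refine (norm_kickB_sub_le K _ _).trans ?_
    have h1 : |x / √w - x / √ω| = |x| * |(√w)⁻¹ - (√ω)⁻¹| := by
      rw [← abs_mul]
      congr 1
      ring
    rw [h1]
    rw [Real.norm_eq_abs, Real.norm_eq_abs] at hw
    calc |K| * (|x| * |(√w)⁻¹ - (√ω)⁻¹|) ≤ |K| * (|x| * (C * |w - ω|)) := by gcongr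
      _ = _ := by ring
  · have h1 := hasDerivAt_iff_tendsto_slope.1 (hasDerivAt_kickB_div_sqrt K hω x)
    have h2 := (h1.sub_const (d x)).mul_const (ψ x)
    simpa [hd] using h2

/-! ### Strong derivatives of products -/

lemma tendsto_isometric_apply {A : ℝ → L2 →L[ℂ] L2} (hA : ∀ w φ, ‖A w φ‖ = ‖φ‖) {l : Filter ℝ}
    {s : ℝ → L2} {φ χ : L2} (hc : Tendsto (fun w => A w φ) l (𝓝 χ)) (hs : Tendsto s l (𝓝 φ)) :
    Tendsto (fun w => A w (s w)) l (𝓝 χ) := by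
  have h : Tendsto (fun w => A w (s w - φ)) l (𝓝 0) := by
    rw [tendsto_zero_iff_norm_tendsto_zero]
    simp only [hA]
    rw [← tendsto_zero_iff_norm_tendsto_zero]
    exact tendsto_sub_nhds_zero_iff.2 hs
  simpa using h.add hc

/-- The difference quotient splits into `A w` applied to the quotient of `b`, plus the quotient of
`A` at the fixed vector `b ω`. The uniform bound from isometry lets strong continuity handle the
first part. -/
lemma hasDerivAt_isometric_apply {A : ℝ → L2 →L[ℂ] L2} (hA : ∀ w φ, ‖A w φ‖ = ‖φ‖) {ω : ℝ}
    (hc : ∀ φ, Tendsto (fun w => A w φ) (𝓝 ω) (𝓝 (A ω φ))) {b : ℝ → L2} {b' a' : L2}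
    (hb : HasDerivAt b b' ω) (ha : HasDerivAt (fun w => A w (b ω)) a' ω) :
    HasDerivAt (fun w => A w (b w)) (A ω b' + a') ω := by
  rw [hasDerivAt_iff_tendsto_slope] at hb ha ⊢
  refine ((tendsto_isometric_apply hA ((hc b').mono_left nhdsWithin_le_nhds) hb).add ha).congr
    fun w => ?_
  have e : ∀ φ : L2, A w ((w - ω)⁻¹ • φ) = (w - ω)⁻¹ • A w φ := fun φ =>
    (A w).map_smul_of_tower _ _
  rw [slope_def_module, slope_def_module, slope_def_module, e, map_sub, ← smul_add,
    sub_add_sub_cancel]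

/-! ### The quantum Fisher information of a differentiable family of unit vectors -/

lemma norm_sub_proj_sq {u v : L2} (hu : ‖u‖ = 1) :
    ‖v - inner ℂ u v • u‖ ^ 2 = ‖v‖ ^ 2 - ‖inner ℂ u v‖ ^ 2 := by
  have h := @norm_sub_sq ℂ _ _ _ _ v (inner ℂ u v • u)
  rw [h, norm_smul, hu, inner_smul_right, ← inner_conj_symm v u, Complex.mul_conj', mul_one]
  have : RCLike.re ((‖inner ℂ u v‖ : ℂ) ^ 2) = ‖inner ℂ u v‖ ^ 2 := by
    norm_cast
  rw [this]
  ring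

/-- The projection orthogonal to `y ω` annihilates `y ω`, so the infidelity over `ε²` is the squared
norm of the projected difference quotient, and the projection is continuous. -/
lemma tendsto_fidelity {y : ℝ → L2} {y' : L2} {ω : ℝ} (hy : ∀ w, ‖y w‖ = 1)
    (hd : HasDerivAt y y' ω) :
    Tendsto (fun ε => 4 * ((1 - ‖inner ℂ (y ω) (y (ω + ε))‖ ^ 2) / ε ^ 2)) (𝓝[≠] 0)
      (𝓝 (4 * (‖y'‖ ^ 2 - ‖inner ℂ (y ω) y'‖ ^ 2))) := by
  rw [← norm_sub_proj_sq (hy ω)]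
  have hcont : Continuous fun v : L2 => v - inner ℂ (y ω) v • y ω := by fun_prop
  have h := ((((hcont.tendsto y').comp hd.tendsto_slope_zero).norm).pow 2).const_mul 4
  refine h.congr' ?_
  filter_upwards [self_mem_nhdsWithin] with ε hε
  have hyy : inner ℂ (y ω) (y ω) = 1 := by
    rw [inner_self_eq_norm_sq_to_K, hy]
    simp
  have e : ε⁻¹ • (y (ω + ε) - y ω) - inner ℂ (y ω) (ε⁻¹ • (y (ω + ε) - y ω)) • y ω =
      ε⁻¹ • (y (ω + ε) - inner ℂ (y ω) (y (ω + ε)) • y ω) := by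
    rw [inner_smul_right_eq_smul, inner_sub_right, hyy, smul_assoc, ← smul_sub, sub_smul, one_smul]
    congr 1
    abel
  simp only [Function.comp_apply]
  rw [e, norm_smul, mul_pow, norm_sub_proj_sq (hy ω), hy, norm_inv, Real.norm_eq_abs, inv_pow, sq_abs]
  ring

lemma re_inner_eq_zero_of_unit {y : ℝ → L2} {y' : L2} {ω : ℝ} (hy : ∀ w, ‖y w‖ = 1)
    (hd : HasDerivAt y y' ω) : (inner ℂ (y ω) y').re = 0 := by
  have h1 := hd.inner ℂ hd
  have h2 : (fun w => inner ℂ (y w) (y w)) = fun _ => (1 : ℂ) := by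
    funext w
    rw [inner_self_eq_norm_sq_to_K, hy]
    simp
  rw [h2] at h1
  have h3 := h1.unique (hasDerivAt_const ω (1 : ℂ))
  rw [← inner_conj_symm y' (y ω), Complex.add_conj] at h3
  have h4 : (2 : ℝ) * (inner ℂ (y ω) y').re = 0 := by exact_mod_cast h3
  linarith

/-- The squared norm of a polynomial combination of three vectors is a polynomial. -/
lemma exists_polynomial_variance (p : Fin 3 → Polynomial ℝ) (hp : ∀ i, (p i).natDegree ≤ 3)
    (v : Fin 3 → L2) (ψ : L2) : ∃ q : Polynomial ℝ, q.natDegree ≤ 6 ∧ ∀ t : ℝ,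
      4 * (‖∑ i, (((p i).eval t : ℝ) : ℂ) • v i‖ ^ 2 -
        (inner ℂ ψ (∑ i, (((p i).eval t : ℝ) : ℂ) • v i)).re ^ 2) = q.eval t := by
  refine ⟨∑ i, ∑ j, Polynomial.C (4 * ((inner ℂ (v i) (v j)).re -
    (inner ℂ ψ (v i)).re * (inner ℂ ψ (v j)).re)) * (p i * p j), ?_, fun t => ?_⟩
  · refine Polynomial.natDegree_sum_le_of_forall_le _ _ fun i _ =>
      Polynomial.natDegree_sum_le_of_forall_le _ _ fun j _ =>
        (Polynomial.natDegree_C_mul_le _ _).trans (Polynomial.natDegree_mul_le.trans ?_)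
    have := hp i
    have := hp j
    omega
  · have h1 : ‖∑ i, (((p i).eval t : ℝ) : ℂ) • v i‖ ^ 2 =
        ∑ i, ∑ j, (p i).eval t * (p j).eval t * (inner ℂ (v i) (v j)).re := by
      have h := inner_self_eq_norm_sq (𝕜 := ℂ) (∑ i, (((p i).eval t : ℝ) : ℂ) • v i)
      rw [← h, sum_inner]
      simp only [inner_sum, inner_smul_left, inner_smul_right, Complex.conj_ofReal, map_sum,
        RCLike.re_to_complex, Complex.re_ofReal_mul]
      refine Finset.sum_congr rfl fun i _ => Finset.sum_congr rfl fun j _ => by ring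
    have h2 : (inner ℂ ψ (∑ i, (((p i).eval t : ℝ) : ℂ) • v i)).re =
        ∑ i, (p i).eval t * (inner ℂ ψ (v i)).re := by
      simp only [inner_sum, inner_smul_right, Complex.re_sum, Complex.re_ofReal_mul]
    rw [h1, h2, sq, Finset.sum_mul_sum, ← Finset.sum_sub_distrib, Finset.mul_sum]
    simp only [Polynomial.eval_finsetSum, Polynomial.eval_mul, Polynomial.eval_C,
      ← Finset.sum_sub_distrib, Finset.mul_sum]
    refine Finset.sum_congr rfl fun i _ => Finset.sum_congr rfl fun j _ => by ring

/-! ### The Floquet operator at the resonance -/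

/-- The graph of the multiplication operator `X sin X`. -/
def IsXSin (ω : ℝ) (ψ θ : L2) : Prop :=
  ∀ᵐ x : ℝ, θ x = (x / √ω : ℝ) * (sinB (x / √ω) * ψ x)

lemma IsXSin.kick {ω : ℝ} {ψ θ : L2} (h : IsXSin ω ψ θ) (K : ℝ) :
    IsXSin ω (kick K ω ψ) (kick K ω θ) := by
  filter_upwards [h, coeFn_funX ω (kickB K) ψ, coeFn_funX ω (kickB K) θ] with x h1 h2 h3
  rw [KHO.kick, h3, h2, h1]
  ring

/-- The function `x sin x` is even. -/
lemma IsXSin.parity {ω : ℝ} {ψ θ : L2} (h : IsXSin ω ψ θ) : IsXSin ω (parity ψ) (parity θ) := by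
  filter_upwards [ae_neg h, coeFn_parity ψ, coeFn_parity θ] with x h1 h2 h3
  rw [h3, h2, h1, neg_div, sinB_apply, sinB_apply, Real.sin_neg]
  push_cast
  ring

lemma coeFn_position_smul {ψ φ χ : L2} (ha : IsAnn ψ φ) (hc : IsCre ψ χ) (c : ℝ) :
    ∀ᵐ x : ℝ, ((c : ℂ) • (φ + χ) : L2) x = ((c * √2 * x : ℝ) : ℂ) * ψ x := by
  filter_upwards [coeFn_position ha hc, Lp.coeFn_smul (c : ℂ) (φ + χ)] with x h1 h2
  rw [h2, Pi.smul_apply, h1, smul_eq_mul]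
  push_cast
  ring

lemma IsAnn.exists_position {ψ φ : L2} (ha : IsAnn ψ φ) : ∃ ξ : L2, ∀ᵐ x : ℝ, ξ x = x * ψ x := by
  obtain ⟨χ, hc⟩ := ha.exists_isCre
  refine ⟨(((√2)⁻¹ : ℝ) : ℂ) • (φ + χ), ?_⟩
  filter_upwards [coeFn_position_smul ha hc (√2)⁻¹] with x hx
  rw [hx, inv_mul_cancel₀ (by positivity), one_mul]

lemma isXSin_of_position {ω : ℝ} {ψ α η : L2} (ha : IsAnn (sinX ω ψ) α) (hc : IsCre (sinX ω ψ) η) :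
    IsXSin ω ψ ((((√(2 * ω))⁻¹ : ℝ) : ℂ) • (α + η)) := by
  filter_upwards [coeFn_position_smul ha hc (√(2 * ω))⁻¹, coeFn_funX ω sinB ψ] with x h1 h2
  rw [h1, sinX, h2, Real.sqrt_mul (by norm_num)]
  congr 2
  field_simp

lemma IsNum.iterate_parity {ψ ν : L2} (h : IsNum ψ ν) (n : ℕ) :
    IsNum (KHO.parity^[n] ψ) (KHO.parity^[n] ν) := by
  induction n with
  | zero => exact h
  | succ n ih =>
    rw [Function.iterate_succ_apply', Function.iterate_succ_apply']
    exact ih.parity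

lemma kick_iterate_parity (K ω : ℝ) (n : ℕ) (ψ : L2) :
    kick K ω (parity^[n] ψ) = parity^[n] (kick K ω ψ) := by
  induction n generalizing ψ with
  | zero => rfl
  | succ n ih => rw [Function.iterate_succ_apply, Function.iterate_succ_apply, ih, parity_kick]

lemma kick_kick_nat (K ω : ℝ) (n : ℕ) (ψ : L2) :
    kick K ω (kick (n * K) ω ψ) = kick ((n + 1 : ℕ) * K) ω ψ := by
  rw [← kick_pow, ← kick_pow, pow_succ', mul_apply_eq_comp]

lemma floquet_apply {τ K ω : ℝ} (hres : ω * τ = Real.pi) (ψ : L2) :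
    floquet τ K ω ψ = kick K ω (parity ψ) := by
  rw [floquet, ContinuousLinearMap.comp_apply, hres, rotation_pi]

/-- An identity at the resonant frequency only: the two families have different derivatives there.
-/
lemma floquetKickFirst_eq {τ K ω : ℝ} (hres : ω * τ = Real.pi) :
    floquetKickFirst τ K ω = floquet τ K ω := by
  ext1 ψ
  rw [floquetKickFirst, ContinuousLinearMap.comp_apply, floquet_apply hres, hres, rotation_pi,
    parity_kick]

/-- Parity commutes with the even kick, so parities and kicks separate and the kick strengths add.
-/
lemma floquet_pow_apply {τ K ω : ℝ} (hres : ω * τ = Real.pi) (t : ℕ) (ψ : L2) :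
    (floquet τ K ω ^ t) ψ = parity^[t] (kick (t * K) ω ψ) := by
  induction t with
  | zero => simp [kick, kickB_zero, funX_one]
  | succ t ih =>
    rw [pow_succ', mul_apply_eq_comp, ih, floquet_apply hres, ← Function.iterate_succ_apply' parity,
      kick_iterate_parity, kick_kick_nat]

lemma kick_floquet_pow_apply {τ K ω : ℝ} (hres : ω * τ = Real.pi) (t : ℕ) (ψ : L2) :
    kick K ω ((floquet τ K ω ^ t) ψ) = parity^[t] (kick ((t + 1 : ℕ) * K) ω ψ) := by
  rw [floquet_pow_apply hres, kick_iterate_parity, kick_kick_nat]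

lemma IsXSin.floquet_pow {τ K ω : ℝ} (hres : ω * τ = Real.pi) {ψ θ : L2} (h : IsXSin ω ψ θ) (t : ℕ) :
    IsXSin ω ((floquet τ K ω ^ t) ψ) ((floquet τ K ω ^ t) θ) := by
  induction t with
  | zero => exact h
  | succ t ih =>
    rw [pow_succ', mul_apply_eq_comp, mul_apply_eq_comp, floquet_apply hres, floquet_apply hres]
    exact ih.parity.kick K

lemma norm_floquet (τ K ω : ℝ) (ψ : L2) : ‖floquet τ K ω ψ‖ = ‖ψ‖ := by
  rw [floquet, ContinuousLinearMap.comp_apply, norm_kick, norm_rotation]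

lemma norm_floquetKickFirst (τ K ω : ℝ) (ψ : L2) : ‖floquetKickFirst τ K ω ψ‖ = ‖ψ‖ := by
  rw [floquetKickFirst, ContinuousLinearMap.comp_apply, norm_rotation, norm_kick]

lemma tendsto_rotation_mul (τ ω : ℝ) (ψ : L2) :
    Tendsto (fun w => rotation (w * τ) ψ) (𝓝 ω) (𝓝 (rotation (ω * τ) ψ)) :=
  (tendsto_rotation (ω * τ) ψ).comp ((continuous_mul_const τ).tendsto ω)

lemma hasDerivAt_rotation_mul {ψ ν : L2} (h : IsNum ψ ν) (τ ω : ℝ) :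
    HasDerivAt (fun w => rotation (w * τ) ψ) (-Complex.I • rotation (ω * τ) ((τ : ℂ) • ν)) ω := by
  have h1 := (hasDerivAt_rotation h (ω * τ)).scomp ω ((hasDerivAt_id ω).mul_const τ)
  convert! h1 using 1
  rw [map_smul, one_mul, smul_comm]
  exact Complex.coe_smul τ _

lemma tendsto_floquet (τ K : ℝ) {ω : ℝ} (hω : 0 < ω) (ψ : L2) :
    Tendsto (fun w => floquet τ K w ψ) (𝓝 ω) (𝓝 (floquet τ K ω ψ)) :=
  tendsto_isometric_apply (A := kick K) (norm_kick K) (tendsto_kick K hω _)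
    (tendsto_rotation_mul τ ω ψ)

lemma tendsto_floquetKickFirst (τ K : ℝ) {ω : ℝ} (hω : 0 < ω) (ψ : L2) :
    Tendsto (fun w => floquetKickFirst τ K w ψ) (𝓝 ω) (𝓝 (floquetKickFirst τ K ω ψ)) :=
  tendsto_isometric_apply (A := fun w => rotation (w * τ)) (fun w => norm_rotation (w * τ))
    (tendsto_rotation_mul τ ω _) (tendsto_kick K hω ψ)

lemma hasDerivAt_floquet {τ K ω : ℝ} (hω : 0 < ω) (hres : ω * τ = Real.pi) {ψ ν θ : L2}
    (hn : IsNum ψ ν) (hθ : IsXSin ω ψ θ) :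
    HasDerivAt (fun w => floquet τ K w ψ)
      (-Complex.I • floquet τ K ω ((τ : ℂ) • ν + ((K / (2 * ω) : ℝ) : ℂ) • θ)) ω := by
  obtain ⟨ξ, hξ⟩ : ∃ ξ : L2, ∀ᵐ x : ℝ, ξ x = x * parity ψ x := by
    obtain ⟨φ, ha, -⟩ := hn.parity
    exact ha.exists_position
  have hk := hasDerivAt_kick K hω hξ hθ.parity
  rw [← rotation_pi ψ, ← hres] at hk
  have h := hasDerivAt_isometric_apply (A := kick K) (norm_kick K) (tendsto_kick K hω)
    (hasDerivAt_rotation_mul hn τ ω) hk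
  convert! h using 1
  rw [hres, rotation_pi, floquet_apply hres]
  simp only [map_add, map_smul, smul_add, smul_smul]
  congr 2
  push_cast
  ring

lemma hasDerivAt_floquetKickFirst {τ K ω : ℝ} (hω : 0 < ω) {ψ φ ν θ : L2}
    (ha : IsAnn ψ φ) (hn : IsNum (kick K ω ψ) (kick K ω ν)) (hθ : IsXSin ω ψ θ) :
    HasDerivAt (fun w => floquetKickFirst τ K w ψ)
      (-Complex.I • floquetKickFirst τ K ω ((τ : ℂ) • ν + ((K / (2 * ω) : ℝ) : ℂ) • θ)) ω := by
  obtain ⟨ξ, hξ⟩ := ha.exists_position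
  have h := hasDerivAt_isometric_apply (A := fun w => rotation (w * τ))
    (fun w => norm_rotation (w * τ)) (tendsto_rotation_mul τ ω) (hasDerivAt_kick K hω hξ hθ)
    (hasDerivAt_rotation_mul hn τ ω)
  convert! h using 1
  rw [floquetKickFirst, ContinuousLinearMap.comp_apply]
  simp only [map_add, map_smul, smul_add, smul_smul]
  rw [add_comm]
  congr 2
  push_cast
  ring

/-! ### Derivatives of powers -/

lemma norm_pow_apply {A : L2 →L[ℂ] L2} (hA : ∀ φ, ‖A φ‖ = ‖φ‖) (t : ℕ) (φ : L2) :
    ‖(A ^ t) φ‖ = ‖φ‖ := by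
  induction t with
  | zero => rfl
  | succ t ih => rw [pow_succ', mul_apply_eq_comp, hA, ih]

lemma adjoint_apply_of_isometric {A : L2 →L[ℂ] L2} (hA : ∀ φ, ‖A φ‖ = ‖φ‖) (φ : L2) :
    ContinuousLinearMap.adjoint A (A φ) = φ := by
  have h := (ContinuousLinearMap.norm_map_iff_adjoint_comp_self A).1 hA
  exact congrArg (fun B : L2 →L[ℂ] L2 => B φ) h

/-- Induction with the outermost factor split off. Only the derivative of one factor along the orbit
`U^s ψ` is required, and `g s` is that derivative pulled back to time zero. -/
lemma hasDerivAt_pow_apply {U : ℝ → L2 →L[ℂ] L2} (hU : ∀ w φ, ‖U w φ‖ = ‖φ‖) {ω : ℝ}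
    (hc : ∀ φ, Tendsto (fun w => U w φ) (𝓝 ω) (𝓝 (U ω φ))) {ψ : L2} {g : ℕ → L2}
    (hd : ∀ t, HasDerivAt (fun w => U w ((U ω ^ t) ψ)) (-Complex.I • U ω ((U ω ^ t) (g t))) ω)
    (t : ℕ) : HasDerivAt (fun w => (U w ^ t) ψ)
      (-Complex.I • (U ω ^ t) (∑ s ∈ Finset.range t, g s)) ω := by
  induction t with
  | zero => simpa using hasDerivAt_const ω ψ
  | succ t ih =>
    have h := hasDerivAt_isometric_apply hU hc ih (hd t)
    simp only [pow_succ', mul_apply_eq_comp]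
    convert! h using 1
    rw [Finset.sum_range_succ, map_add, map_add, smul_add, map_smul]

/-! ### The closed form of the generator -/

/-- The value of `closedForm` in terms of the vectors `ν = a†aψ`, `δ = (sin X a - a† sin X)ψ`,
`ζ = sin² X ψ` and `θ = X sin X ψ`. -/
def closedVec (ω τ K t s₁ s₂ : ℝ) (ν δ ζ θ : L2) : L2 :=
  (τ : ℂ) • ((t : ℂ) • ν - (Complex.I * K * s₁ / (√(2 * ω) : ℝ)) • δ
    + ((K ^ 2 * s₂ / (2 * ω) : ℝ) : ℂ) • ζ) + ((K * t / (2 * ω) : ℝ) : ℂ) • θ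

lemma S1_succ (t : ℝ) : S1 (t + 1) = S1 t + t := by
  unfold S1; ring

lemma S2_succ (t : ℝ) : S2 (t + 1) = S2 t + t ^ 2 := by
  unfold S2; ring

/-- The accumulated kick strength in period `s` is `(s + c)K`, with `c = 0` for free evolution first
and `c = 1` for kick first. Both values are zeros of `S1` and `S2`, so the induction starts from the
empty sum. -/
lemma sum_eq_closedVec {ω : ℝ} (hω : 0 < ω) (τ K : ℝ) {c : ℝ} (h1 : S1 c = 0) (h2 : S2 c = 0)
    (ν δ ζ θ : L2) (t : ℕ) :
    ∑ s ∈ Finset.range t, ((τ : ℂ) • (ν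
        - (Complex.I * (((s + c) * K / √(2 * ω) : ℝ) : ℂ)) • δ
        + ((((s + c) * K / √(2 * ω) : ℝ) : ℂ) ^ 2) • ζ) + ((K / (2 * ω) : ℝ) : ℂ) • θ) =
      closedVec ω τ K t (S1 (t + c)) (S2 (t + c)) ν δ ζ θ := by
  induction t with
  | zero => simp [closedVec, h1, h2]
  | succ t ih =>
    have hsq : ((√(2 * ω) : ℝ) : ℂ) ^ 2 = 2 * ω := by
      rw [← Complex.ofReal_pow, Real.sq_sqrt (by positivity)]
      push_cast
      rfl
    rw [Finset.sum_range_succ, ih, closedVec, closedVec,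
      show ((t + 1 : ℕ) : ℝ) + c = (t + c) + 1 by push_cast; ring, S1_succ, S2_succ]
    push_cast
    simp only [div_pow, hsq]
    module

lemma mem_ofBdd_domain (B : L2 →L[ℂ] L2) (ψ : L2) : ψ ∈ (ofBdd B).domain := Submodule.mem_top

lemma IsNum.closedForm {ψ φ ν η α : L2} {ω : ℝ} (ha : IsAnn ψ φ) (hc : IsCre φ ν)
    (hα : IsAnn (sinX ω ψ) α) (hη : IsCre (sinX ω ψ) η) (τ K t s₁ s₂ : ℝ) :
    ∃ h : ψ ∈ (closedForm ω τ K t s₁ s₂).domain, closedForm ω τ K t s₁ s₂ ⟨ψ, h⟩ =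
      closedVec ω τ K t s₁ s₂ ν (sinX ω φ - η) (sinX ω (sinX ω ψ))
        ((((√(2 * ω))⁻¹ : ℝ) : ℂ) • (α + η)) := by
  obtain ⟨h1, rfl⟩ := isNum_iff.1 ⟨φ, ha, hc⟩
  obtain ⟨h2, rfl⟩ := isAnn_iff.1 ha
  obtain ⟨h3, rfl⟩ := isAnn_iff.1 hα
  obtain ⟨h4, rfl⟩ := isCre_iff.1 hη
  have m1 : ψ ∈ (opMul (ofBdd (sinX ω)) annih).domain :=
    (mem_opMul_domain _ _ _).2 ⟨h2, mem_ofBdd_domain _ _⟩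
  have m2 : ψ ∈ (opMul creat (ofBdd (sinX ω))).domain :=
    (mem_opMul_domain _ _ _).2 ⟨mem_ofBdd_domain _ _, h4⟩
  have m3 : ψ ∈ (opMul (posX ω) (ofBdd (sinX ω))).domain :=
    (mem_opMul_domain _ _ _).2 ⟨mem_ofBdd_domain _ _, h3, h4⟩
  have m : ψ ∈ (KHO.closedForm ω τ K t s₁ s₂).domain :=
    ⟨⟨⟨h1, m1, m2⟩, mem_ofBdd_domain (sinX ω ∘L sinX ω) ψ⟩, m3⟩
  exact ⟨m, rfl⟩

/-- A scalar multiple of a partial operator keeps its domain, even for the scalar zero, so the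
number term restricts the domain also at `t = 0`. -/
lemma closedForm_domain_le (ω τ K t s₁ s₂ : ℝ) :
    (closedForm ω τ K t s₁ s₂).domain ≤ number.domain := fun _ h => h.1.1.1

/-- Data attached to a vector of `D(a†a)`. -/
lemma exists_ladder {ψ : L2} (ω : ℝ) (h : ψ ∈ number.domain) :
    ∃ φ ν η α : L2, IsAnn ψ φ ∧ IsCre φ ν ∧ IsAnn (sinX ω ψ) α ∧ IsCre (sinX ω ψ) η := by
  obtain ⟨φ, ha, hc⟩ := isNum_iff.2 ⟨h, rfl⟩
  -- `sin X` preserves `D(a)`, and `D(a) ⊆ D(a†)`, so all remaining terms are defined on `D(a†a)`.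
  have hα := ha.mulX ω hasTemperateGrowth_sinB hasDerivAt_sinB
  obtain ⟨η, hη⟩ := hα.exists_isCre
  exact ⟨φ, _, η, _, ha, hc, hα, hη⟩

lemma closedForm_domain (ω τ K t s₁ s₂ : ℝ) :
    (closedForm ω τ K t s₁ s₂).domain = number.domain := by
  refine le_antisymm (closedForm_domain_le _ _ _ _ _ _) fun ψ h => ?_
  obtain ⟨φ, ν, η, α, ha, hc, hα, hη⟩ := exists_ladder ω h
  exact (IsNum.closedForm ha hc hα hη _ _ _ _ _).1

/-! ### Derivatives of Floquet powers at the resonance -/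

lemma hasDerivAt_floquet_pow {τ K ω : ℝ} (hω : 0 < ω) (hres : ω * τ = Real.pi) {ψ φ ν η α : L2}
    (ha : IsAnn ψ φ) (hc : IsCre φ ν) (hα : IsAnn (sinX ω ψ) α) (hη : IsCre (sinX ω ψ) η) (t : ℕ) :
    HasDerivAt (fun w => (floquet τ K w ^ t) ψ) (-Complex.I • (floquet τ K ω ^ t)
      (closedVec ω τ K t (S1 t) (S2 t) ν (sinX ω φ - η) (sinX ω (sinX ω ψ))
        ((((√(2 * ω))⁻¹ : ℝ) : ℂ) • (α + η)))) ω := by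
  have hθ := isXSin_of_position hα hη
  have hs := sum_eq_closedVec hω τ K (c := 0) (by simp [S1]) (by simp [S2]) ν (sinX ω φ - η)
    (sinX ω (sinX ω ψ)) ((((√(2 * ω))⁻¹ : ℝ) : ℂ) • (α + η)) t
  simp only [add_zero] at hs
  rw [← hs]
  refine hasDerivAt_pow_apply (norm_floquet τ K) (tendsto_floquet τ K hω) (fun s => ?_) t
  -- `U^s ψ` is `P^s` of a kick of strength `sK`, so the conjugation formula evaluates `a†a` on it.
  have hn := (IsNum.kick ha hc ω hη (s * K)).iterate_parity s
  rw [← floquet_pow_apply hres, ← floquet_pow_apply hres] at hn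
  rw [map_add, map_smul, map_smul]
  exact hasDerivAt_floquet hω hres hn (hθ.floquet_pow hres s)

lemma hasDerivAt_floquetKickFirst_pow {τ K ω : ℝ} (hω : 0 < ω) (hres : ω * τ = Real.pi)
    {ψ φ ν η α : L2} (ha : IsAnn ψ φ) (hc : IsCre φ ν) (hα : IsAnn (sinX ω ψ) α)
    (hη : IsCre (sinX ω ψ) η) (t : ℕ) :
    HasDerivAt (fun w => (floquetKickFirst τ K w ^ t) ψ) (-Complex.I • (floquetKickFirst τ K ω ^ t)
      (closedVec ω τ K t (S1 (t + 1)) (S2 (t + 1)) ν (sinX ω φ - η) (sinX ω (sinX ω ψ))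
        ((((√(2 * ω))⁻¹ : ℝ) : ℂ) • (α + η)))) ω := by
  have hθ := isXSin_of_position hα hη
  rw [← sum_eq_closedVec hω τ K (c := 1) (by simp [S1]) (by simp [S2])]
  refine hasDerivAt_pow_apply (norm_floquetKickFirst τ K) (tendsto_floquetKickFirst τ K hω)
    (fun s => ?_) t
  -- Here `a†a` acts after the kick of the current period, hence strength `(s + 1)K`.
  have hn := (IsNum.kick ha hc ω hη ((s + 1 : ℕ) * K)).iterate_parity s
  rw [← kick_floquet_pow_apply hres, ← kick_floquet_pow_apply hres] at hn
  -- Strength `sK` is used only to place `U^s ψ` in `D(a)`, as the derivative of the kick requires.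
  obtain ⟨φ', ha', -⟩ := (IsNum.kick ha hc ω hη (s * K)).iterate_parity s
  rw [← floquet_pow_apply hres] at ha'
  rw [Nat.cast_add, Nat.cast_one] at hn
  have h := hasDerivAt_floquetKickFirst (τ := τ) hω ha' hn (hθ.floquet_pow hres s)
  -- This rewrites the operators at the fixed `ω`, not the family being differentiated.
  rw [floquetKickFirst_eq hres] at h ⊢
  rw [map_add, map_smul, map_smul]
  exact h

/-! ### The generator and the quantum Fisher information -/

lemma generator_eq_of_hasDerivAt {U : ℝ → L2 →L[ℂ] L2} (hU : ∀ w φ, ‖U w φ‖ = ‖φ‖) {ω : ℝ} {t : ℕ}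
    {ψ H : L2} (hd : HasDerivAt (fun w => (U w ^ t) ψ) (-Complex.I • (U ω ^ t) H) ω) :
    ∃ h : ψ ∈ (generator U ω t).domain, generator U ω t ⟨ψ, h⟩ = H := by
  refine ⟨hd.differentiableAt, ?_⟩
  change Complex.I • ContinuousLinearMap.adjoint (U ω ^ t) (deriv (fun w : ℝ => (U w ^ t) ψ) ω) = H
  rw [hd.deriv, map_smul, smul_smul, adjoint_apply_of_isometric (norm_pow_apply (hU ω) t)]
  simp

lemma isQFI_of_hasDerivAt {U : ℝ → L2 →L[ℂ] L2} (hU : ∀ w φ, ‖U w φ‖ = ‖φ‖) {ω : ℝ} {t : ℕ}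
    {ψ H : L2} (hψ : ‖ψ‖ = 1)
    (hd : HasDerivAt (fun w => (U w ^ t) ψ) (-Complex.I • (U ω ^ t) H) ω) :
    IsQFI U ω t ψ (4 * (‖H‖ ^ 2 - (inner ℂ ψ H).re ^ 2)) := by
  have hy : ∀ w, ‖(U w ^ t) ψ‖ = 1 := fun w => by rw [norm_pow_apply (hU w), hψ]
  have h := tendsto_fidelity hy hd
  have hre := re_inner_eq_zero_of_unit hy hd
  have hin : inner ℂ ((U ω ^ t) ψ) (-Complex.I • (U ω ^ t) H) = -Complex.I * inner ℂ ψ H := by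
    rw [inner_smul_right, ← ContinuousLinearMap.adjoint_inner_right,
      adjoint_apply_of_isometric (norm_pow_apply (hU ω) t)]
  rw [hin] at h hre
  -- Conservation of the norm makes the mean of the generator real, so its modulus squared is the
  -- square of its real part.
  have him : (inner ℂ ψ H).im = 0 := by simpa using hre
  have hn : ‖-Complex.I * inner ℂ ψ H‖ ^ 2 = (inner ℂ ψ H).re ^ 2 := by
    rw [norm_mul, norm_neg, Complex.norm_I, one_mul, ← Complex.normSq_eq_norm_sq,
      Complex.normSq_apply, him]
    ring
  rw [hn, norm_smul, norm_neg, Complex.norm_I, one_mul, norm_pow_apply (hU ω)] at h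
  refine h.congr fun ε => ?_
  rw [ContinuousLinearMap.adjoint_inner_right, norm_inner_symm]

lemma closedForm_le_generator {U : ℝ → L2 →L[ℂ] L2} (hU : ∀ w φ, ‖U w φ‖ = ‖φ‖)
    {ω τ K s₁ s₂ : ℝ} {t : ℕ}
    (hd : ∀ ψ φ ν η α : L2, IsAnn ψ φ → IsCre φ ν → IsAnn (sinX ω ψ) α → IsCre (sinX ω ψ) η →
      HasDerivAt (fun w => (U w ^ t) ψ) (-Complex.I • (U ω ^ t)
        (closedVec ω τ K t s₁ s₂ ν (sinX ω φ - η) (sinX ω (sinX ω ψ))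
          ((((√(2 * ω))⁻¹ : ℝ) : ℂ) • (α + η)))) ω) :
    closedForm ω τ K t s₁ s₂ ≤ generator U ω t := by
  have key : ∀ ψ : L2, ψ ∈ number.domain → ∃ H, (∃ h : ψ ∈ (closedForm ω τ K t s₁ s₂).domain,
      closedForm ω τ K t s₁ s₂ ⟨ψ, h⟩ = H) ∧
      ∃ h : ψ ∈ (generator U ω t).domain, generator U ω t ⟨ψ, h⟩ = H := fun ψ hψ => by
    obtain ⟨φ, ν, η, α, ha, hc, hα, hη⟩ := exists_ladder ω hψ
    exact ⟨_, IsNum.closedForm ha hc hα hη τ K t s₁ s₂,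
      generator_eq_of_hasDerivAt hU (hd ψ φ ν η α ha hc hα hη)⟩
  refine ⟨fun ψ hψ => ?_, fun x y hxy => ?_⟩
  · obtain ⟨H, -, h, -⟩ := key ψ (closedForm_domain_le _ _ _ _ _ _ hψ)
    exact h
  · obtain ⟨ψ, hψ⟩ := x
    obtain ⟨ψ', hψ'⟩ := y
    obtain rfl : ψ = ψ' := hxy
    obtain ⟨H, ⟨_, h1⟩, _, h2⟩ := key ψ (closedForm_domain_le _ _ _ _ _ _ hψ)
    rw [h1, h2]

lemma exists_qfi_polynomial {U : ℝ → L2 →L[ℂ] L2} (hU : ∀ w φ, ‖U w φ‖ = ‖φ‖) {ω τ K c : ℝ}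
    {ψ ν δ ζ θ : L2} (hψ : ‖ψ‖ = 1)
    (hd : ∀ t : ℕ, HasDerivAt (fun w => (U w ^ t) ψ) (-Complex.I • (U ω ^ t)
        (closedVec ω τ K t (S1 (t + c)) (S2 (t + c)) ν δ ζ θ)) ω) :
    ∃ p : Polynomial ℝ, p.natDegree ≤ 6 ∧ ∀ t : ℕ,
      ∃ h : ψ ∈ (generator U ω t).domain,
        4 * variance (generator U ω t) ⟨ψ, h⟩ = p.eval (t : ℝ) ∧
        IsQFI U ω t ψ (p.eval (t : ℝ)) := by
  -- The three coefficients are `t`, `S₁(t + c)` and `S₂(t + c)`, of degrees 1, 2 and 3. The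
  -- imaginary unit goes into the vectors so that the coefficients stay real.
  let T : Polynomial ℝ := Polynomial.X + Polynomial.C c
  let P : Fin 3 → Polynomial ℝ := ![Polynomial.X, Polynomial.C (1 / 2) * (T * (T - 1)),
    Polynomial.C (1 / 6) * (T * (T - 1) * (2 * T - 1))]
  let V : Fin 3 → L2 := ![(τ : ℂ) • ν + ((K / (2 * ω) : ℝ) : ℂ) • θ,
    -((τ : ℂ) • (Complex.I * K / (√(2 * ω) : ℝ)) • δ),
    (τ : ℂ) • ((K ^ 2 / (2 * ω) : ℝ) : ℂ) • ζ]
  have hP : ∀ i, (P i).natDegree ≤ 3 := by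
    intro i
    fin_cases i
    · simp [P]
    · refine le_trans (b := 2) ?_ (by norm_num)
      simp only [P, T, Fin.mk_one, Matrix.cons_val_one, Matrix.cons_val_zero]
      compute_degree
    · simp only [P, T, Fin.reduceFinMk, Matrix.cons_val]
      compute_degree
  obtain ⟨q, hq, hqe⟩ := exists_polynomial_variance P hP V ψ
  have hv : ∀ t : ℕ, closedVec ω τ K t (S1 (t + c)) (S2 (t + c)) ν δ ζ θ =
      ∑ i, (((P i).eval (t : ℝ) : ℝ) : ℂ) • V i := fun t => by
    rw [Fin.sum_univ_three]
    simp only [P, V, T, closedVec, S1, S2, Matrix.cons_val, Polynomial.eval_mul, Polynomial.eval_add,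
      Polynomial.eval_sub, Polynomial.eval_C, Polynomial.eval_X, Polynomial.eval_one,
      Polynomial.eval_ofNat]
    push_cast
    module
  refine ⟨q, hq, fun t => ?_⟩
  obtain ⟨h, hH⟩ := generator_eq_of_hasDerivAt hU (hd t)
  have hqt := hqe t
  rw [← hv t] at hqt
  refine ⟨h, ?_, ?_⟩
  · rw [variance, hH, hqt]
  · rw [← hqt]
    exact isQFI_of_hasDerivAt hU hψ (hd t)

end KHO

end

theorem mainTheorem10 (ω τ K : ℝ) (hω : 0 < ω) (hres : ω * τ = 2 * Real.pi / 2) :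
    -- closed form of the generator, on the whole domain of `a†a`, for either order of the factors
    (∀ t : ℕ,
      (KHO.closedForm ω τ K t (KHO.S1 t) (KHO.S2 t)).domain = KHO.number.domain ∧
      KHO.closedForm ω τ K t (KHO.S1 t) (KHO.S2 t) ≤ KHO.generator (KHO.floquet τ K) ω t) ∧
    (∀ t : ℕ,
      (KHO.closedForm ω τ K t (KHO.S1 (t + 1)) (KHO.S2 (t + 1))).domain = KHO.number.domain ∧
      KHO.closedForm ω τ K t (KHO.S1 (t + 1)) (KHO.S2 (t + 1)) ≤
        KHO.generator (KHO.floquetKickFirst τ K) ω t) ∧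
    -- the quantum Fisher information is four times the variance of the generator, and is a
    -- polynomial in `t` of degree at most six
    (∀ U : ℝ → KHO.L2 →L[ℂ] KHO.L2, U = KHO.floquet τ K ∨ U = KHO.floquetKickFirst τ K →
      ∀ ψ : KHO.L2, ψ ∈ KHO.number.domain → ‖ψ‖ = 1 →
        ∃ p : Polynomial ℝ, p.natDegree ≤ 6 ∧ ∀ t : ℕ,
          ∃ h : ψ ∈ (KHO.generator U ω t).domain,
            4 * KHO.variance (KHO.generator U ω t) ⟨ψ, h⟩ = p.eval (t : ℝ) ∧
            KHO.IsQFI U ω t ψ (p.eval (t : ℝ))) := by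
  have hπ : ω * τ = Real.pi := by rw [hres]; ring
  refine ⟨fun t => ⟨KHO.closedForm_domain _ _ _ _ _ _, ?_⟩,
    fun t => ⟨KHO.closedForm_domain _ _ _ _ _ _, ?_⟩, ?_⟩
  · exact KHO.closedForm_le_generator (KHO.norm_floquet τ K) fun ψ φ ν η α ha hc hα hη =>
      KHO.hasDerivAt_floquet_pow hω hπ ha hc hα hη t
  · exact KHO.closedForm_le_generator (KHO.norm_floquetKickFirst τ K) fun ψ φ ν η α ha hc hα hη =>
      KHO.hasDerivAt_floquetKickFirst_pow hω hπ ha hc hα hη t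
  · rintro U (rfl | rfl) ψ hψ h1
    · obtain ⟨φ, ν, η, α, ha, hc, hα, hη⟩ := KHO.exists_ladder ω hψ
      have hd := KHO.hasDerivAt_floquet_pow (K := K) hω hπ ha hc hα hη
      refine KHO.exists_qfi_polynomial (KHO.norm_floquet τ K) (τ := τ) (K := K) (c := 0) (ν := ν)
        (δ := KHO.sinX ω φ - η) (ζ := KHO.sinX ω (KHO.sinX ω ψ))
        (θ := (((√(2 * ω))⁻¹ : ℝ) : ℂ) • (α + η)) h1 fun t => ?_
      rw [add_zero]
      exact hd t
    · obtain ⟨φ, ν, η, α, ha, hc, hα, hη⟩ := KHO.exists_ladder ω hψ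
      exact KHO.exists_qfi_polynomial (KHO.norm_floquetKickFirst τ K) (c := 1) h1 fun t =>
        KHO.hasDerivAt_floquetKickFirst_pow hω hπ ha hc hα hη t
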